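/- All quantum systems are finite-dimensional; composites $AB$ have Hilbert space $\mathcal H_A\otimes\mathcal H_B$, and tripartite composites $(AB)C$ and $A(BC)$ are identified. A resource theory assigns to every system $X$ a set $\mathcal S_X$ of density matrices on $X$ (the free states) such that, for all systems $A,B,X$: (A1) $\rho_A\otimes\rho_B\in\mathcal S_{AB}$ whenever $\rho_A\in\mathcal S_A$ and $\rho_B\in\mathcal S_B$; (A2) if $\rho_{AB}\in\mathcal S_{AB}$ then $\mathrm{Tr}_B[\rho_{AB}]\in\mathcal S_A$ and $\mathrm{Tr}_A[\rho_{AB}]\in\mathcal S_B$; (A3) $\mathcal S_X$ is convex and (topologically) closed; (A4) $\mathcal S_X$ contains a full-rank state. The free operations $\mathcal O_{A\to B}$ are the completely resource non-generating channels, i.e. the completely positive trace-preserving maps $\Lambda$ from $A$ to $B$ with $(\mathrm{id}_R\otimes\Lambda)(\gamma_{RA})\in\mathcal S_{RB}$ for every system $R$ and every $\gamma_{RA}\in\mathcal S_{RA}$. Let $D(\rho\Vert\sigma)=\mathrm{Tr}[\rho(\log\rho-\log\sigma)]$ if $\mathrm{supp}\,\rho\subseteq\mathrm{supp}\,\sigma$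 and $D(\rho\Vert\sigma)=+\infty$ otherwise, and define the reversed relative entropy of resource of a state $\rho_X$ by $\bar R(\rho_X)=\inf_{\gamma_X\in\mathcal S_X}D(\gamma_X\Vert\rho_X)$. Given a state $\rho_S$ and $\epsilon>0$, a free operation $\Lambda\in\mathcal O_{SC\to S'C}$ implements strict $(\rho_S,\epsilon)$-robust catalysis with catalyst state $\tau_C$ if for every state $\sigma_S$ with $\Vert\sigma_S-\rho_S\Vert_1\le\epsilon$ there is a state $\tilde\sigma_{S'}$ with $\Lambda(\sigma_S\otimes\tau_C)=\tilde\sigma_{S'}\otimes\tau_C$. Then in every such resource theory: 1. (Faithfulness) For every state $\rho_X$, $\bar R(\rho_X)\ge 0$, with equality if and only if $\rho_X\in\mathcal S_X$; and $\bar R(\rho_X)<\infty$ if $\rho_X$ has full rank. 2. (Monotonicity) $\bar R(\Lambda(\rho_A))\le\bar R(\rho_A)$ for every state $\rho_A$ and every $\Lambda\in\mathcal O_{A\to B}$. 3. (Additivity) $\bar R(\rho_A\otimes\omega_B)=\bar R(\rho_A)+\bar R(\omega_B)$ for all states $\rho_A,\omega_B$. 4. (No-go) Let $\Lambda\in\mathcal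 O_{SC\to S'C}$ implement strict $(\rho_S,\epsilon)$-robust catalysis, for some state $\rho_S$ and some $\epsilon>0$, with a full-rank catalyst $\tau_C$. Then for every free state $\gamma_S\in\mathcal S_S$ there is a free state $\sigma_{S'}\in\mathcal S_{S'}$ with $\Lambda(\gamma_S\otimes\tau_C)=\sigma_{S'}\otimes\tau_C$, and the induced map $X_S\mapsto\mathrm{Tr}_C[\Lambda(X_S\otimes\tau_C)]$ is a free operation in $\mathcal O_{S\to S'}$. In particular, strict robust catalysis with a full-rank catalyst cannot turn a free state into a non-free one. -/

import Mathlib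

open scoped Kronecker ComplexOrder

universe u v

noncomputable section

namespace QRes

/-! ### Matrix notions for finite-dimensional quantum theory -/

section MatrixNotions

variable {n m : Type*} [Fintype n] [DecidableEq n] [Fintype m] [DecidableEq m]

/-- Density matrices. -/
def IsState (ρ : Matrix n n ℂ) : Prop :=
  ρ.PosSemidef ∧ ρ.trace = 1

/-- Full-rank matrices. -/
def IsFullRank (ρ : Matrix n n ℂ) : Prop :=
  ρ.rank = Fintype.card n

/-- The trace norm `‖M‖₁ = Tr √(M† M)`. -/
def traceNorm (M : Matrix n n ℂ) : ℝ :=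
  (cfc Real.sqrt (M.conjTranspose * M)).trace.re

open Classical in
/-- The Umegaki relative entropy `D(ρ‖σ) = Tr[ρ (log ρ - log σ)]` if the support of `ρ` is
contained in the support of `σ` (that is, `ker σ ⊆ ker ρ`), and `+∞` otherwise. The functional
calculus uses `Real.log 0 = 0`, i.e. logarithms are taken on the supports. -/
def relEntropy (ρ σ : Matrix n n ℂ) : EReal :=
  if ∀ v : n → ℂ, σ.mulVec v = 0 → ρ.mulVec v = 0 then
    (((ρ * (cfc Real.log ρ - cfc Real.log σ)).trace.re : ℝ) : EReal)
  else ⊤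

/-- The map `id ⊗ Λ` with an ancilla whose basis is indexed by `κ`. -/
def ampliate (κ : Type*) (Λ : Matrix n n ℂ →ₗ[ℂ] Matrix m m ℂ)
    (M : Matrix (κ × n) (κ × n) ℂ) : Matrix (κ × m) (κ × m) ℂ :=
  Matrix.of fun p q => Λ (Matrix.of fun i j => M (p.1, i) (q.1, j)) p.2 q.2

/-- Quantum channels: completely positive trace-preserving linear maps. -/
structure IsChannel (Λ : Matrix n n ℂ →ₗ[ℂ] Matrix m m ℂ) : Prop where
  completelyPositive : ∀ (k : ℕ) (M : Matrix (Fin k × n) (Fin k × n) ℂ),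
    M.PosSemidef → (ampliate (Fin k) Λ M).PosSemidef
  tracePreserving : ∀ M : Matrix n n ℂ, (Λ M).trace = M.trace

end MatrixNotions

/-! ### Systems and their composition -/

/-- A family of finite-dimensional quantum systems with labels in `Sys`. Two different systems may
have the same dimension. The Hilbert space of `X` has an orthonormal basis indexed by `Idx X`, and
the Hilbert space of the composite `comp A B` is the tensor product of those of `A` and `B`:
its basis is identified with the product basis. -/
structure Systems (Sys : Type u) where
  Idx : Sys → Type v
  fintypeIdx : ∀ X, Fintype (Idx X)
  decEqIdx : ∀ X, DecidableEq (Idx X)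
  comp : Sys → Sys → Sys
  pair : ∀ A B, Idx (comp A B) ≃ Idx A × Idx B

attribute [instance] Systems.fintypeIdx Systems.decEqIdx

namespace Systems

variable {Sys : Type u} (Q : Systems.{u, v} Sys)

/-- Operators on the Hilbert space of `X`. -/
abbrev Mat (X : Sys) : Type v := Matrix (Q.Idx X) (Q.Idx X) ℂ

/-- Linear maps from operators on `A` to operators on `B`. -/
abbrev Op (A B : Sys) : Type v := Q.Mat A →ₗ[ℂ] Q.Mat B

variable {Q}

/-- The tensor product `ρ_A ⊗ ω_B` as an operator on the composite system. -/
def tensor {A B : Sys} (ρ : Q.Mat A) (ω : Q.Mat B) : Q.Mat (Q.comp A B) :=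
  (ρ ⊗ₖ ω).submatrix (Q.pair A B) (Q.pair A B)

/-- The partial trace `Tr_B` over the second factor. -/
def traceSnd {A B : Sys} (M : Q.Mat (Q.comp A B)) : Q.Mat A :=
  Matrix.of fun i j => ∑ k, M ((Q.pair A B).symm (i, k)) ((Q.pair A B).symm (j, k))

/-- The partial trace `Tr_A` over the first factor. -/
def traceFst {A B : Sys} (M : Q.Mat (Q.comp A B)) : Q.Mat B :=
  Matrix.of fun i j => ∑ k, M ((Q.pair A B).symm (k, i)) ((Q.pair A B).symm (k, j))

/-- The extension `id_R ⊗ Λ` of a map `Λ` from `A` to `B`. -/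
def idTensor (R : Sys) {A B : Sys} (Λ : Q.Op A B) (M : Q.Mat (Q.comp R A)) :
    Q.Mat (Q.comp R B) :=
  (ampliate (Q.Idx R) Λ (M.submatrix (Q.pair R A).symm (Q.pair R A).symm)).submatrix
    (Q.pair R B) (Q.pair R B)

variable (Q) in
/-- The canonical identification of the bases of `(AB)C` and `A(BC)`. -/
def regroup (A B C : Sys) :
    Q.Idx (Q.comp (Q.comp A B) C) ≃ Q.Idx (Q.comp A (Q.comp B C)) :=
  (Q.pair (Q.comp A B) C).trans <|
    ((Q.pair A B).prodCongr (Equiv.refl _)).trans <|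
      (Equiv.prodAssoc _ _ _).trans <|
        ((Equiv.refl _).prodCongr (Q.pair B C).symm).trans (Q.pair A (Q.comp B C)).symm

/-- The map `X ↦ Tr_C[Λ(X ⊗ τ)]` induced on the system by a map `Λ` from `SC` to `S'C` and an
operator `τ` on `C`. -/
def induced {S S' C : Sys} (Λ : Q.Op (Q.comp S C) (Q.comp S' C)) (τ : Q.Mat C) : Q.Op S S' where
  toFun X := traceSnd (Λ (tensor X τ))
  map_add' X Y := by
    have h : tensor (X + Y) τ = tensor X τ + tensor Y τ := by
      ext i j; simp [tensor, Matrix.kroneckerMap_apply, add_mul]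
    ext i j
    simp [h, traceSnd, Finset.sum_add_distrib]
  map_smul' c X := by
    have h : tensor (c • X) τ = c • tensor X τ := by
      ext i j; simp [tensor, Matrix.kroneckerMap_apply, mul_assoc]
    ext i j
    simp [h, traceSnd, Finset.mul_sum]

end Systems

open Systems

/-! ### Resource theories -/

/-- A resource theory on a family of systems: a set of free states for every system, subject to
the basic assumptions. -/
structure ResourceTheory {Sys : Type u} (Q : Systems.{u, v} Sys) where
  /-- the set of free states of each system -/
  free : ∀ X : Sys, Set (Q.Mat X)
  free_isState : ∀ X, ∀ ρ ∈ free X, IsState ρ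
  /-- products of free states are free -/
  tensor_mem : ∀ A B, ∀ ρ ∈ free A, ∀ ω ∈ free B, tensor ρ ω ∈ free (Q.comp A B)
  /-- marginals of free states are free -/
  traceSnd_mem : ∀ A B, ∀ ρ ∈ free (Q.comp A B), traceSnd ρ ∈ free A
  traceFst_mem : ∀ A B, ∀ ρ ∈ free (Q.comp A B), traceFst ρ ∈ free B
  free_convex : ∀ X, Convex ℝ (free X)
  /-- every system has a full-rank free state -/
  exists_fullRank : ∀ X, ∃ γ ∈ free X, IsFullRank γ
  /-- free sets are closed, without which the reversed relative entropy is not faithful -/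
  free_closed : ∀ X, IsClosed (free X)
  /-- the free states of a tripartite system `ABC` do not depend on how it is grouped -/
  free_regroup : ∀ (A B C : Sys) (ρ : Q.Mat (Q.comp (Q.comp A B) C)),
    ρ ∈ free (Q.comp (Q.comp A B) C) ↔
      Matrix.reindex (Q.regroup A B C) (Q.regroup A B C) ρ ∈ free (Q.comp A (Q.comp B C))

namespace ResourceTheory

variable {Sys : Type u} {Q : Systems.{u, v} Sys} (T : ResourceTheory Q)

/-- Free operations: the completely resource non-generating channels. -/
structure IsFreeOp {A B : Sys} (Λ : Q.Op A B) : Prop where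
  isChannel : IsChannel Λ
  crng : ∀ R : Sys, ∀ γ ∈ T.free (Q.comp R A), idTensor R Λ γ ∈ T.free (Q.comp R B)

/-- The reversed relative entropy of resource `inf_{γ ∈ free X} D(γ‖ρ)`. -/
def revRelEntropy {X : Sys} (ρ : Q.Mat X) : EReal :=
  ⨅ γ ∈ T.free X, relEntropy γ ρ

/-- The free operation `Λ` from `SC` to `S'C` implements `(ρ, ε)`-robust catalysis with the
catalyst state `τ`: the catalyst is recovered exactly for all system states `ε`-close to `ρ`. -/
structure IsRobustCatalysis {S S' C : Sys} (Λ : Q.Op (Q.comp S C) (Q.comp S' C))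
    (ρ : Q.Mat S) (ε : ℝ) (τ : Q.Mat C) : Prop where
  isFreeOp : T.IsFreeOp Λ
  state_isState : IsState ρ
  pos : 0 < ε
  catalyst_isState : IsState τ
  recovers : ∀ σ : Q.Mat S, IsState σ → traceNorm (σ - ρ) ≤ ε →
    traceFst (Λ (tensor σ τ)) = τ

/-- Strict robust catalysis: moreover the output system is uncorrelated with the catalyst. -/
structure IsStrictRobustCatalysis {S S' C : Sys} (Λ : Q.Op (Q.comp S C) (Q.comp S' C))
    (ρ : Q.Mat S) (ε : ℝ) (τ : Q.Mat C) : Prop extends T.IsRobustCatalysis Λ ρ ε τ where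
  uncorrelated : ∀ σ : Q.Mat S, IsState σ → traceNorm (σ - ρ) ≤ ε →
    ∃ σ' : Q.Mat S', IsState σ' ∧ Λ (tensor σ τ) = tensor σ' τ

end ResourceTheory

end QRes

end

open QRes QRes.Systems

set_option linter.unusedSectionVars false

noncomputable section

namespace QRes

open Matrix

section Diagonalization

variable {n ι κ : Type*} [Fintype n] [DecidableEq n] [Fintype ι] [DecidableEq ι]
  [Fintype κ] [DecidableEq κ]

/-- `A = U diag(a) U†` with `U` unitary and `a` real. -/
structure Diagonalizes (A : Matrix n n ℂ) (U : Matrix n ι ℂ) (a : ι → ℝ) : Prop where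
  star_mul : Uᴴ * U = 1
  mul_star : U * Uᴴ = 1
  eq : A = U * diagonal (fun i => (a i : ℂ)) * Uᴴ

/-- The diagonal entries of `A` in the basis given by the columns of `V`. -/
def population (V : Matrix n ι ℂ) (A : Matrix n n ℂ) (j : ι) : ℝ :=
  ((Vᴴ * A * V) j j).re

/-- `Tr[A log A]`. -/
def negEntropy (A : Matrix n n ℂ) : ℝ := (A * cfc Real.log A).trace.re

/-- The transition probabilities between two bases. -/
def overlap (U : Matrix n ι ℂ) (V : Matrix n κ ℂ) (i : ι) (j : κ) : ℝ :=
  Complex.normSq ((Uᴴ * V) i j)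

theorem _root_.Matrix.IsHermitian.exists_diagonalizes {A : Matrix n n ℂ} (hA : A.IsHermitian) :
    ∃ (U : Matrix n n ℂ) (a : n → ℝ), Diagonalizes A U a :=
  ⟨hA.eigenvectorUnitary, hA.eigenvalues, Unitary.coe_star_mul_self _,
    Unitary.coe_mul_star_self _, hA.spectral_theorem⟩

namespace Diagonalizes

variable {A : Matrix n n ℂ} {U : Matrix n ι ℂ} {a : ι → ℝ}

theorem conj_eq (h : Diagonalizes A U a) : Uᴴ * A * U = diagonal (fun i => (a i : ℂ)) := by
  rw [h.eq]
  calc Uᴴ * (U * diagonal (fun i => (a i : ℂ)) * Uᴴ) * U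
      = (Uᴴ * U) * diagonal (fun i => (a i : ℂ)) * (Uᴴ * U) := by simp only [Matrix.mul_assoc]
    _ = _ := by simp [h.star_mul]

theorem population_self (h : Diagonalizes A U a) (i : ι) : population U A i = a i := by
  simp [population, h.conj_eq]

theorem nonneg (h : Diagonalizes A U a) (hA : A.PosSemidef) (i : ι) : 0 ≤ a i := by
  have := (hA.conjTranspose_mul_mul_same U).diag_nonneg (i := i)
  rw [h.conj_eq, diagonal_apply_eq] at this
  exact_mod_cast this

theorem trace_eq (h : Diagonalizes A U a) : A.trace = ((∑ i, a i : ℝ) : ℂ) := by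
  rw [h.eq, Matrix.trace_mul_comm, ← Matrix.mul_assoc, h.star_mul, Matrix.one_mul,
    trace_diagonal]
  push_cast; rfl

theorem pow_eq (h : Diagonalizes A U a) (k : ℕ) :
    A ^ k = U * diagonal (fun i => ((a i ^ k : ℝ) : ℂ)) * Uᴴ := by
  induction k with
  | zero => simpa using h.mul_star.symm
  | succ k ih =>
    rw [pow_succ, ih]
    nth_rewrite 1 [h.eq]
    calc U * diagonal (fun i => ((a i ^ k : ℝ) : ℂ)) * Uᴴ *
          (U * diagonal (fun i => (a i : ℂ)) * Uᴴ)
        = U * diagonal (fun i => ((a i ^ k : ℝ) : ℂ)) * (Uᴴ * U) *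
          diagonal (fun i => (a i : ℂ)) * Uᴴ := by simp only [Matrix.mul_assoc]
      _ = _ := by
        rw [h.star_mul, Matrix.mul_one, Matrix.mul_assoc U, diagonal_mul_diagonal]
        simp [pow_succ]

theorem aeval_eq (h : Diagonalizes A U a) (P : Polynomial ℝ) :
    Polynomial.aeval A P = U * diagonal (fun i => ((P.eval (a i) : ℝ) : ℂ)) * Uᴴ := by
  induction P using Polynomial.induction_on' with
  | add p q hp hq =>
    simp only [map_add, hp, hq, Polynomial.eval_add, Complex.ofReal_add]
    rw [← diagonal_add, Matrix.mul_add, Matrix.add_mul]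
  | monomial k c =>
    rw [Polynomial.aeval_monomial, h.pow_eq, ← Algebra.smul_def]
    have : (fun i => ((Polynomial.eval (a i) (Polynomial.monomial k c) : ℝ) : ℂ)) =
        c • fun i => ((a i ^ k : ℝ) : ℂ) := by
      ext i; simp
    rw [this, diagonal_smul, Matrix.mul_smul, Matrix.smul_mul]

theorem isHermitian (h : Diagonalizes A U a) : A.IsHermitian := by
  rw [h.eq]
  refine isHermitian_mul_mul_conjTranspose U ?_
  ext i j
  by_cases hij : i = j
  · subst hij; simp
  · simp [diagonal_apply_ne _ hij, diagonal_apply_ne _ (Ne.symm hij)]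

theorem cfc_eq (h : Diagonalizes A U a) (f : ℝ → ℝ) :
    cfc f A = U * diagonal (fun i => ((f (a i) : ℝ) : ℂ)) * Uᴴ := by
  classical
  have hfin : (spectrum ℝ A).Finite := Matrix.finite_real_spectrum
  let F : Finset ℝ := hfin.toFinset ∪ Finset.univ.image a
  let P := Lagrange.interpolate F id f
  have hP : ∀ x ∈ F, P.eval x = f x := fun x hx =>
    Lagrange.eval_interpolate_at_node (v := id) f Function.injective_id.injOn hx
  have h1 : cfc f A = cfc P.eval A := by
    refine cfc_congr fun x hx => (hP x ?_).symm
    simp [F, hx]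
  rw [h1, cfc_polynomial P A (show IsSelfAdjoint A from h.isHermitian), h.aeval_eq]
  congr! 4 with i
  rw [hP]
  simp [F]

theorem negEntropy_eq (h : Diagonalizes A U a) :
    negEntropy A = ∑ i, a i * Real.log (a i) := by
  have : A * cfc Real.log A = cfc (fun x => x * Real.log x) A := by
    rw [h.cfc_eq, h.cfc_eq]
    nth_rewrite 1 [h.eq]
    calc U * diagonal (fun i => (a i : ℂ)) * Uᴴ *
          (U * diagonal (fun i => (Real.log (a i) : ℂ)) * Uᴴ)
        = U * diagonal (fun i => (a i : ℂ)) * (Uᴴ * U) *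
          diagonal (fun i => (Real.log (a i) : ℂ)) * Uᴴ := by simp only [Matrix.mul_assoc]
      _ = _ := by
        rw [h.star_mul, Matrix.mul_one, Matrix.mul_assoc U, diagonal_mul_diagonal]
        simp
  rw [negEntropy, this, h.cfc_eq, Matrix.trace_mul_comm, ← Matrix.mul_assoc, h.star_mul,
    Matrix.one_mul, trace_diagonal]
  simp

end Diagonalizes

theorem population_nonneg (V : Matrix n ι ℂ) {A : Matrix n n ℂ} (hA : A.PosSemidef) (j : ι) :
    0 ≤ population V A j :=
  (Complex.le_def.1 (hA.conjTranspose_mul_mul_same V).diag_nonneg).1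

theorem re_trace_mul_conj_diagonal (V : Matrix n ι ℂ) (A : Matrix n n ℂ) (x : ι → ℝ) :
    (A * (V * diagonal (fun j => (x j : ℂ)) * Vᴴ)).trace.re = ∑ j, population V A j * x j := by
  have : (A * (V * diagonal (fun j => (x j : ℂ)) * Vᴴ)).trace =
      ((Vᴴ * A * V) * diagonal (fun j => (x j : ℂ))).trace := by
    rw [← Matrix.mul_assoc, Matrix.trace_mul_comm]
    simp only [Matrix.mul_assoc]
  rw [this]
  simp [Matrix.trace, population, mul_diagonal]

theorem population_eq_sum_overlap {A : Matrix n n ℂ} {U : Matrix n ι ℂ} {a : ι → ℝ}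
    (h : Diagonalizes A U a) (V : Matrix n κ ℂ) (j : κ) :
    population V A j = ∑ i, overlap U V i j * a i := by
  have : Vᴴ * A * V = (Uᴴ * V)ᴴ * diagonal (fun i => (a i : ℂ)) * (Uᴴ * V) := by
    rw [h.eq, conjTranspose_mul, conjTranspose_conjTranspose]
    simp only [Matrix.mul_assoc]
  rw [population, this, Matrix.mul_apply, Complex.re_sum]
  refine Finset.sum_congr rfl fun i _ => ?_
  rw [mul_diagonal, conjTranspose_apply, overlap, Complex.normSq_apply]
  simp
  ring

theorem overlap_nonneg (U : Matrix n ι ℂ) (V : Matrix n κ ℂ) (i : ι) (j : κ) :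
    0 ≤ overlap U V i j := Complex.normSq_nonneg _

theorem overlap_swap (U : Matrix n ι ℂ) (V : Matrix n κ ℂ) (i : ι) (j : κ) :
    overlap U V i j = overlap V U j i := by
  have : Vᴴ * U = (Uᴴ * V)ᴴ := by simp
  rw [overlap, overlap, this, conjTranspose_apply]
  exact (Complex.normSq_conj _).symm

theorem sum_overlap_left {U : Matrix n ι ℂ} {V : Matrix n κ ℂ} (hU : U * Uᴴ = 1)
    (hV : Vᴴ * V = 1) (j : κ) : ∑ i, overlap U V i j = 1 := by
  have : (Uᴴ * V)ᴴ * (Uᴴ * V) = 1 := by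
    rw [conjTranspose_mul, conjTranspose_conjTranspose, Matrix.mul_assoc, ← Matrix.mul_assoc U,
      hU, Matrix.one_mul, hV]
  have := congrArg Complex.re (congrFun (congrFun this j) j)
  rw [Matrix.mul_apply, Complex.re_sum] at this
  simp only [one_apply_eq, Complex.one_re] at this
  rw [← this]
  refine Finset.sum_congr rfl fun i _ => ?_
  rw [conjTranspose_apply, overlap, Complex.normSq_apply]
  simp

theorem sum_overlap_right {U : Matrix n ι ℂ} {V : Matrix n κ ℂ} (hU : Uᴴ * U = 1)
    (hV : V * Vᴴ = 1) (i : ι) : ∑ j, overlap U V i j = 1 := by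
  simp only [overlap_swap U V]
  exact sum_overlap_left hV hU i

theorem ker_le_iff_population {A B : Matrix n n ℂ} (hA : A.PosSemidef) {V : Matrix n ι ℂ}
    {b : ι → ℝ} (hB : Diagonalizes B V b) :
    (∀ v : n → ℂ, B.mulVec v = 0 → A.mulVec v = 0) ↔ ∀ j, b j = 0 → population V A j = 0 := by
  have key : ∀ j, population V A j = 0 ↔ A *ᵥ (V *ᵥ Pi.single j 1) = 0 := by
    intro j
    have h1 : (Vᴴ * A * V) j j = star (V *ᵥ Pi.single j 1) ⬝ᵥ (A *ᵥ (V *ᵥ Pi.single j 1)) := by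
      rw [star_mulVec, ← dotProduct_mulVec, mulVec_mulVec, mulVec_mulVec,
        Matrix.mulVec_single_one]
      simp [dotProduct, Pi.single_apply]
    rw [← hA.dotProduct_mulVec_zero_iff, ← h1, population]
    refine ⟨fun h => ?_, fun h => by simp [h]⟩
    have h2 := Complex.le_def.1 ((hA.conjTranspose_mul_mul_same V).diag_nonneg (i := j))
    exact Complex.ext h h2.2.symm
  constructor
  · intro h j hj
    rw [key]
    apply h
    rw [hB.eq, mulVec_mulVec, Matrix.mul_assoc, hB.star_mul, Matrix.mul_one, ← mulVec_mulVec,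
      Matrix.mulVec_single_one]
    have : (diagonal fun i => (b i : ℂ)).col j = 0 := by
      ext i
      by_cases hij : i = j
      · subst hij; simp [hj]
      · simp [hij]
    rw [this, mulVec_zero]
  · intro h v hv
    have hc : ∀ j, (b j : ℂ) * (Vᴴ *ᵥ v) j = 0 := by
      intro j
      have : Vᴴ *ᵥ (B *ᵥ v) = diagonal (fun i => (b i : ℂ)) *ᵥ (Vᴴ *ᵥ v) := by
        rw [hB.eq, mulVec_mulVec, mulVec_mulVec, ← Matrix.mul_assoc, ← Matrix.mul_assoc,
          hB.star_mul, Matrix.one_mul]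
      rw [hv, mulVec_zero] at this
      have := congrFun this j
      rw [mulVec_diagonal] at this
      exact this.symm
    have hv' : v = V *ᵥ (Vᴴ *ᵥ v) := by rw [mulVec_mulVec, hB.mul_star, one_mulVec]
    rw [hv']
    have hsum : Vᴴ *ᵥ v = ∑ j, (Vᴴ *ᵥ v) j • Pi.single j (1 : ℂ) := by
      ext i; simp [Finset.sum_apply, Pi.single_apply]
    rw [hsum, mulVec_sum, mulVec_sum]
    refine Finset.sum_eq_zero fun j _ => ?_
    rw [mulVec_smul, mulVec_smul]
    by_cases hj : b j = 0
    · rw [(key j).1 (h j hj), smul_zero]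
    · rw [(mul_eq_zero.1 (hc j)).resolve_left (by exact_mod_cast hj), zero_smul]

open Classical in
theorem relEntropy_eq {A B : Matrix n n ℂ} (hA : A.PosSemidef) {V : Matrix n ι ℂ}
    {b : ι → ℝ} (hB : Diagonalizes B V b) :
    relEntropy A B = if ∀ j, b j = 0 → population V A j = 0 then
      ((negEntropy A - ∑ j, population V A j * Real.log (b j) : ℝ) : EReal) else ⊤ := by
  rw [relEntropy, hB.cfc_eq, Matrix.mul_sub, Matrix.trace_sub, Complex.sub_re,
    re_trace_mul_conj_diagonal, ← negEntropy]
  simp only [ker_le_iff_population hA hB]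

end Diagonalization

section Klein

variable {n ι κ : Type*} [Fintype n] [DecidableEq n] [Fintype ι] [DecidableEq ι]
  [Fintype κ] [DecidableEq κ]

theorem sub_add_sq_div_four_le_mul_log {a b : ℝ} (ha : 0 < a) (ha1 : a ≤ 1) (hb : 0 < b)
    (hb1 : b ≤ 1) : a - b + (a - b) ^ 2 / 4 ≤ a * (Real.log a - Real.log b) := by
  obtain ⟨r, hr, rfl⟩ : ∃ r : ℝ, 0 < r ∧ a = r ^ 2 :=
    ⟨√a, Real.sqrt_pos.2 ha, (Real.sq_sqrt ha.le).symm⟩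
  obtain ⟨t, ht, rfl⟩ : ∃ t : ℝ, 0 < t ∧ b = t ^ 2 :=
    ⟨√b, Real.sqrt_pos.2 hb, (Real.sq_sqrt hb.le).symm⟩
  have hr1 : r ≤ 1 := by nlinarith
  have ht1 : t ≤ 1 := by nlinarith
  have hlog := Real.log_le_sub_one_of_pos (div_pos ht hr)
  rw [Real.log_div ht.ne' hr.ne'] at hlog
  have h1 : 2 * r ^ 2 - 2 * r * t ≤ r ^ 2 * (Real.log (r ^ 2) - Real.log (t ^ 2)) := by
    rw [Real.log_pow, Real.log_pow]
    have : r ^ 2 * (t / r) = r * t := by field_simp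
    push_cast
    nlinarith [mul_le_mul_of_nonneg_left hlog (sq_nonneg r)]
  have h2 : (r + t) ^ 2 ≤ 4 := by nlinarith
  nlinarith [mul_le_mul_of_nonneg_left h2 (sq_nonneg (r - t))]

theorem sum_overlap_mul_sq_sub {A B : Matrix n n ℂ} {U : Matrix n ι ℂ} {a : ι → ℝ}
    (hA : Diagonalizes A U a) {V : Matrix n κ ℂ} {b : κ → ℝ} (hB : Diagonalizes B V b) :
    ((A - B)ᴴ * (A - B)).trace.re = ∑ i, ∑ j, overlap U V i j * (a i - b j) ^ 2 := by
  have hAA : (A * A).trace.re = ∑ i, a i * a i := by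
    nth_rewrite 2 [hA.eq]
    rw [re_trace_mul_conj_diagonal]
    simp [hA.population_self]
  have hBB : (B * B).trace.re = ∑ j, b j * b j := by
    nth_rewrite 2 [hB.eq]
    rw [re_trace_mul_conj_diagonal]
    simp [hB.population_self]
  have hAB : (A * B).trace.re = ∑ i, ∑ j, overlap U V i j * a i * b j := by
    rw [hB.eq, re_trace_mul_conj_diagonal, Finset.sum_comm]
    simp [population_eq_sum_overlap hA, Finset.sum_mul]
  have hL : ((A - B)ᴴ * (A - B)).trace.re =
      (A * A).trace.re - 2 * (A * B).trace.re + (B * B).trace.re := by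
    rw [conjTranspose_sub, hA.isHermitian.eq, hB.isHermitian.eq, Matrix.sub_mul, Matrix.mul_sub,
      Matrix.mul_sub]
    simp only [trace_sub, Complex.sub_re, Matrix.trace_mul_comm B A]
    ring
  have e1 : ∑ i, a i * a i = ∑ i, ∑ j, overlap U V i j * (a i * a i) := by
    simp [← Finset.sum_mul, sum_overlap_right hA.star_mul hB.mul_star]
  have e2 : ∑ j, b j * b j = ∑ i, ∑ j, overlap U V i j * (b j * b j) := by
    rw [Finset.sum_comm]
    simp [← Finset.sum_mul, sum_overlap_left hA.mul_star hB.star_mul]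
  rw [hL, hAA, hBB, hAB, e1, e2, Finset.mul_sum, ← Finset.sum_sub_distrib,
    ← Finset.sum_add_distrib]
  refine Finset.sum_congr rfl fun i _ => ?_
  rw [Finset.mul_sum, ← Finset.sum_sub_distrib, ← Finset.sum_add_distrib]
  refine Finset.sum_congr rfl fun j _ => ?_
  ring

theorem Diagonalizes.sum_eq_one {A : Matrix n n ℂ} {U : Matrix n ι ℂ} {a : ι → ℝ}
    (h : Diagonalizes A U a) (hA : IsState A) : ∑ i, a i = 1 := by
  have := h.trace_eq
  rw [hA.2] at this
  exact_mod_cast this.symm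

theorem Diagonalizes.le_one {A : Matrix n n ℂ} {U : Matrix n ι ℂ} {a : ι → ℝ}
    (h : Diagonalizes A U a) (hA : IsState A) (i : ι) : a i ≤ 1 := by
  rw [← h.sum_eq_one hA]
  exact Finset.single_le_sum (fun i _ => h.nonneg hA.1 i) (Finset.mem_univ i)

theorem negEntropy_sub_eq_sum_overlap {A B : Matrix n n ℂ} {U : Matrix n ι ℂ} {a : ι → ℝ}
    (hA : Diagonalizes A U a) {V : Matrix n κ ℂ} {b : κ → ℝ} (hB : Diagonalizes B V b) :
    negEntropy A - ∑ j, population V A j * Real.log (b j) =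
      ∑ i, ∑ j, overlap U V i j * a i * (Real.log (a i) - Real.log (b j)) := by
  have e1 : negEntropy A = ∑ i, ∑ j, overlap U V i j * (a i * Real.log (a i)) := by
    rw [hA.negEntropy_eq]
    simp [← Finset.sum_mul, sum_overlap_right hA.star_mul hB.mul_star]
  have e2 : ∑ j, population V A j * Real.log (b j) =
      ∑ i, ∑ j, overlap U V i j * a i * Real.log (b j) := by
    rw [Finset.sum_comm]
    simp [population_eq_sum_overlap hA, Finset.sum_mul]
  rw [e1, e2, ← Finset.sum_sub_distrib]
  refine Finset.sum_congr rfl fun i _ => ?_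
  rw [← Finset.sum_sub_distrib]
  refine Finset.sum_congr rfl fun j _ => ?_
  ring

theorem overlap_mul_eq_zero_of_population {A : Matrix n n ℂ} (hA0 : A.PosSemidef)
    {U : Matrix n ι ℂ} {a : ι → ℝ} (hA : Diagonalizes A U a) {V : Matrix n κ ℂ} {j : κ}
    (hj : population V A j = 0) (i : ι) : overlap U V i j * a i = 0 := by
  rw [population_eq_sum_overlap hA] at hj
  exact (Finset.sum_eq_zero_iff_of_nonneg
    (fun i _ => mul_nonneg (overlap_nonneg U V i j) (hA.nonneg hA0 i))).1 hj i (Finset.mem_univ i)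

/-- A Pinsker-type bound with the Hilbert–Schmidt distance. -/
theorem trace_sq_sub_le_relEntropy {A B : Matrix n n ℂ} (hA : IsState A) (hB : IsState B) :
    ((((A - B)ᴴ * (A - B)).trace.re / 4 : ℝ) : EReal) ≤ relEntropy A B := by
  obtain ⟨U, a, ha⟩ := hA.1.isHermitian.exists_diagonalizes
  obtain ⟨V, b, hb⟩ := hB.1.isHermitian.exists_diagonalizes
  rw [relEntropy_eq hA.1 hb]
  split_ifs with hs
  · rw [EReal.coe_le_coe_iff, negEntropy_sub_eq_sum_overlap ha hb, sum_overlap_mul_sq_sub ha hb]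
    have hz : ∑ i, ∑ j, overlap U V i j * (a i - b j) = 0 := by
      simp only [mul_sub, Finset.sum_sub_distrib]
      rw [Finset.sum_comm (f := fun i j => overlap U V i j * b j)]
      simp only [← Finset.sum_mul, sum_overlap_right ha.star_mul hb.mul_star,
        sum_overlap_left ha.mul_star hb.star_mul, one_mul, ha.sum_eq_one hA, hb.sum_eq_one hB,
        sub_self]
    rw [← sub_zero (∑ i, ∑ j, overlap U V i j * a i * _), ← hz, Finset.sum_div,
      ← Finset.sum_sub_distrib]
    refine Finset.sum_le_sum fun i _ => ?_
    rw [Finset.sum_div, ← Finset.sum_sub_distrib]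
    refine Finset.sum_le_sum fun j _ => ?_
    have hp := overlap_nonneg U V i j
    have ha0 := ha.nonneg hA.1 i
    have hb0 := hb.nonneg hB.1 j
    have ha1 := ha.le_one hA i
    have hb1 := hb.le_one hB j
    rcases hp.eq_or_lt with hp0 | hp0
    · simp [← hp0]
    rcases ha0.eq_or_lt with ha0 | ha0
    · rw [← ha0]
      have : 0 ≤ b j - b j ^ 2 / 4 := by nlinarith
      nlinarith [mul_nonneg hp this]
    rcases hb0.eq_or_lt with hb0 | hb0
    · exact absurd (overlap_mul_eq_zero_of_population hA.1 ha (hs j hb0.symm) i)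
        (mul_pos hp0 ha0).ne'
    have := mul_le_mul_of_nonneg_left (sub_add_sq_div_four_le_mul_log ha0 ha1 hb0 hb1) hp
    linarith
  · exact le_top

theorem relEntropy_nonneg {A B : Matrix n n ℂ} (hA : IsState A) (hB : IsState B) :
    0 ≤ relEntropy A B := by
  refine le_trans ?_ (trace_sq_sub_le_relEntropy hA hB)
  rw [← EReal.coe_zero, EReal.coe_le_coe_iff]
  have := (Complex.le_def.1 (posSemidef_conjTranspose_mul_self (A - B)).trace_nonneg).1
  simp only [Complex.zero_re] at this
  linarith

theorem relEntropy_self {A : Matrix n n ℂ} : relEntropy A A = 0 := by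
  simp [relEntropy]

theorem norm_sq_le_trace_re (M : Matrix n n ℂ) (i j : n) : ‖M i j‖ ^ 2 ≤ (Mᴴ * M).trace.re := by
  have : (Mᴴ * M).trace.re = ∑ j, ∑ i, ‖M i j‖ ^ 2 := by
    simp only [Matrix.trace, diag_apply, Matrix.mul_apply, Complex.re_sum]
    refine Finset.sum_congr rfl fun j _ => Finset.sum_congr rfl fun i _ => ?_
    rw [conjTranspose_apply, ← Complex.normSq_eq_norm_sq, Complex.normSq_apply]
    simp
  rw [this]
  refine le_trans ?_ (Finset.single_le_sum (f := fun j => ∑ i, ‖M i j‖ ^ 2)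
    (fun j _ => by positivity) (Finset.mem_univ j))
  exact Finset.single_le_sum (f := fun i => ‖M i j‖ ^ 2) (fun i _ => by positivity)
    (Finset.mem_univ i)

end Klein

section Resolvent

open Filter Topology

theorem eq_zero_of_resolvent_le {I J : Type*} [Fintype I] [Fintype J] {c a b : I → ℝ}
    {c' a' b' : J → ℝ} (hc : ∀ i, 0 ≤ c i) (ha : ∀ i, 0 ≤ a i) (hb : ∀ i, 0 ≤ b i)
    (hsupp : ∀ i, b i = 0 → c i = 0)
    (hc' : ∀ i, 0 ≤ c' i) (ha' : ∀ i, 0 ≤ a' i) (hb' : ∀ i, 0 ≤ b' i)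
    (ha0' : ∀ i, a' i = 0 → c' i = 0)
    (h : ∀ s : ℝ, 0 < s →
      ∑ i, c' i * (a' i / (s * a' i + b' i)) ≤ ∑ i, c i * (a i / (s * a i + b i)))
    (j : J) (hj : b' j = 0) : c' j = 0 := by
  by_contra hne
  have haj : 0 < a' j := lt_of_le_of_ne (ha' j) fun h0 => hne (ha0' j h0.symm)
  have hcj : 0 < c' j := lt_of_le_of_ne (hc' j) (Ne.symm hne)
  set K := ∑ i, c i * (a i / b i) with hK
  have hK0 : 0 ≤ K := Finset.sum_nonneg fun i _ =>
    mul_nonneg (hc i) (div_nonneg (ha i) (hb i))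
  have hbound : ∀ s : ℝ, 0 < s → c' j / s ≤ K := by
    intro s hs
    calc c' j / s = c' j * (a' j / (s * a' j + b' j)) := by
          rw [hj]; field_simp; simp
      _ ≤ ∑ i, c' i * (a' i / (s * a' i + b' i)) :=
          Finset.single_le_sum (f := fun i => c' i * (a' i / (s * a' i + b' i)))
            (fun i _ => mul_nonneg (hc' i) (div_nonneg (ha' i)
              (add_nonneg (mul_nonneg hs.le (ha' i)) (hb' i)))) (Finset.mem_univ j)
      _ ≤ _ := h s hs
      _ ≤ K := Finset.sum_le_sum fun i _ => by
          rcases (hb i).eq_or_lt with h0 | h0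
          · simp [hsupp i h0.symm]
          · refine mul_le_mul_of_nonneg_left ?_ (hc i)
            exact div_le_div_of_nonneg_left (ha i) h0
              (by linarith [mul_nonneg hs.le (ha i)])
  have := hbound (c' j / (K + 1)) (by positivity)
  rw [div_div_eq_mul_div, mul_div_cancel_left₀ _ hcj.ne'] at this
  linarith

theorem hasDerivAt_sum_mul_log {I : Type*} [Fintype I] {c a b : I → ℝ}
    (ha : ∀ i, 0 ≤ a i) (hb : ∀ i, 0 ≤ b i) (ha0 : ∀ i, a i = 0 → c i = 0)
    (s : ℝ) (hs : 0 < s) :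
    HasDerivAt (fun s => ∑ i, c i * Real.log (s * a i + b i))
      (∑ i, c i * (a i / (s * a i + b i))) s := by
  refine HasDerivAt.fun_sum fun i _ => ?_
  rcases (ha i).eq_or_lt with h0 | h0
  · simp only [ha0 i h0.symm, zero_mul]; exact hasDerivAt_const s _
  · refine HasDerivAt.const_mul _ (HasDerivAt.log ?_ ?_)
    · simpa using ((hasDerivAt_id s).mul_const (a i)).add_const (b i)
    · have := hb i; positivity

theorem tendsto_sum_mul_log_zero {I : Type*} [Fintype I] {c a b : I → ℝ}
    (hb0 : ∀ i, b i = 0 → c i = 0) :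
    Tendsto (fun s => ∑ i, c i * Real.log (s * a i + b i)) (𝓝[>] 0)
      (𝓝 (∑ i, c i * Real.log (b i))) := by
  refine tendsto_finsetSum _ fun i _ => ?_
  by_cases h0 : b i = 0
  · simp [hb0 i h0]
  · refine Tendsto.const_mul _ (Tendsto.log ?_ h0)
    have : Continuous fun s : ℝ => s * a i + b i := by fun_prop
    simpa using (this.tendsto 0).mono_left nhdsWithin_le_nhds

theorem tendsto_sum_mul_log_inv {I : Type*} [Fintype I] {c a b : I → ℝ}
    (ha : ∀ i, 0 ≤ a i) (hb : ∀ i, 0 ≤ b i) (ha0 : ∀ i, a i = 0 → c i = 0) :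
    Tendsto (fun s => ∑ i, c i * Real.log (s⁻¹ * a i + b i) + (∑ i, c i) * Real.log s) (𝓝[>] 0)
      (𝓝 (∑ i, c i * Real.log (a i))) := by
  have : Tendsto (fun s : ℝ => ∑ i, c i * Real.log (a i + s * b i)) (𝓝[>] 0)
      (𝓝 (∑ i, c i * Real.log (a i))) := by
    refine tendsto_finsetSum _ fun i _ => ?_
    by_cases h0 : a i = 0
    · simp [ha0 i h0]
    · refine Tendsto.const_mul _ (Tendsto.log ?_ h0)
      have : Continuous fun s : ℝ => a i + s * b i := by fun_prop
      simpa using (this.tendsto 0).mono_left nhdsWithin_le_nhds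
  refine this.congr' ?_
  filter_upwards [self_mem_nhdsWithin] with s hs
  have hs : 0 < s := hs
  rw [Finset.sum_mul, ← Finset.sum_add_distrib]
  refine Finset.sum_congr rfl fun i _ => ?_
  rcases (ha i).eq_or_lt with h0 | h0
  · simp [ha0 i h0.symm]
  · rw [← mul_add, ← Real.log_mul (by have := hb i; positivity) hs.ne']
    congr 2
    field_simp

theorem sum_mul_log_le_of_resolvent_le {I J : Type*} [Fintype I] [Fintype J] {c a b : I → ℝ}
    {c' a' b' : J → ℝ}
    (ha : ∀ i, 0 ≤ a i) (hb : ∀ i, 0 ≤ b i)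
    (ha0 : ∀ i, a i = 0 → c i = 0) (hb0 : ∀ i, b i = 0 → c i = 0)
    (ha' : ∀ i, 0 ≤ a' i) (hb' : ∀ i, 0 ≤ b' i)
    (ha0' : ∀ i, a' i = 0 → c' i = 0) (hb0' : ∀ i, b' i = 0 → c' i = 0)
    (hsum : ∑ i, c i = ∑ i, c' i)
    (h : ∀ s : ℝ, 0 < s →
      ∑ i, c' i * (a' i / (s * a' i + b' i)) ≤ ∑ i, c i * (a i / (s * a i + b i))) :
    ∑ i, c' i * (Real.log (a' i) - Real.log (b' i)) ≤
      ∑ i, c i * (Real.log (a i) - Real.log (b i)) := by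
  set H : ℝ → ℝ := fun s => ∑ i, c i * Real.log (s * a i + b i) -
    ∑ i, c' i * Real.log (s * a' i + b' i) with hH
  have hd : ∀ s : ℝ, 0 < s → HasDerivAt H (∑ i, c i * (a i / (s * a i + b i)) -
      ∑ i, c' i * (a' i / (s * a' i + b' i))) s := fun s hs =>
    (hasDerivAt_sum_mul_log ha hb ha0 s hs).sub (hasDerivAt_sum_mul_log ha' hb' ha0' s hs)
  have hmono : MonotoneOn H (Set.Ioi 0) := by
    refine monotoneOn_of_deriv_nonneg (convex_Ioi 0)
      (fun s hs => (hd s hs).continuousAt.continuousWithinAt) ?_ ?_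
    · rw [interior_Ioi]
      exact fun s hs => (hd s hs).differentiableAt.differentiableWithinAt
    · rw [interior_Ioi]
      intro s hs
      rw [(hd s hs).deriv]
      exact sub_nonneg.2 (h s hs)
  have l0 : Tendsto H (𝓝[>] 0) (𝓝 (∑ i, c i * Real.log (b i) - ∑ i, c' i * Real.log (b' i))) :=
    (tendsto_sum_mul_log_zero hb0).sub (tendsto_sum_mul_log_zero hb0')
  have l1 : Tendsto (fun s => H s⁻¹) (𝓝[>] 0)
      (𝓝 (∑ i, c i * Real.log (a i) - ∑ i, c' i * Real.log (a' i))) := by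
    refine ((tendsto_sum_mul_log_inv ha hb ha0).sub (tendsto_sum_mul_log_inv ha' hb' ha0')).congr fun s => ?_
    rw [hsum, hH]
    ring
  have hle := le_of_tendsto_of_tendsto l0 l1 (by
    filter_upwards [self_mem_nhdsWithin, nhdsWithin_le_nhds (Iio_mem_nhds one_pos)] with s hs hs1
    have hs : 0 < s := hs
    have hs1 : s < 1 := hs1
    exact hmono hs (inv_pos.2 hs : (0 : ℝ) < s⁻¹) (hs1.le.trans (one_lt_inv₀ hs |>.2 hs1).le))
  simp only [mul_sub, Finset.sum_sub_distrib]
  linarith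

end Resolvent

section Variational

variable {n ι κ : Type*} [Fintype n] [DecidableEq n] [Fintype ι] [DecidableEq ι]
  [Fintype κ] [DecidableEq κ]

/-- The concave quadratic form in `Y` whose supremum is the resolvent form
`∑ᵢⱼ pᵢⱼ aᵢ² / (s aᵢ + bⱼ)` of the pair `A`, `B`. -/
def resolventForm (s : ℝ) (A B Y : Matrix n n ℂ) : ℝ :=
  2 * (Yᴴ * A).trace.re - s * (A * (Y * Yᴴ)).trace.re - (B * (Yᴴ * Y)).trace.re

theorem trace_diagonal_mul_self (d : ι → ℝ) (Z : Matrix ι κ ℂ) :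
    (diagonal (fun i => (d i : ℂ)) * (Z * Zᴴ)).trace.re =
      ∑ i, ∑ j, d i * Complex.normSq (Z i j) := by
  rw [Matrix.trace, Complex.re_sum]
  refine Finset.sum_congr rfl fun i _ => ?_
  rw [diag_apply, diagonal_mul, Matrix.mul_apply, Complex.re_ofReal_mul, Complex.re_sum,
    Finset.mul_sum]
  refine Finset.sum_congr rfl fun j _ => ?_
  rw [conjTranspose_apply, Complex.normSq_apply]
  simp

theorem resolventForm_conj {A B : Matrix n n ℂ} {U : Matrix n ι ℂ} {a : ι → ℝ}
    (hA : Diagonalizes A U a) {V : Matrix n κ ℂ} {b : κ → ℝ} (hB : Diagonalizes B V b)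
    (s : ℝ) (Z : Matrix ι κ ℂ) :
    resolventForm s A B (U * Z * Vᴴ) = ∑ i, ∑ j,
      (2 * (a i * (star (Z i j) * (Uᴴ * V) i j).re) -
        (s * a i + b j) * Complex.normSq (Z i j)) := by
  have h1 : ((U * Z * Vᴴ)ᴴ * A).trace =
      (Zᴴ * (diagonal (fun i => (a i : ℂ)) * (Uᴴ * V))).trace := by
    have e : (U * Z * Vᴴ)ᴴ * A = V * (Zᴴ * (diagonal (fun i => (a i : ℂ)) * Uᴴ)) := by
      simp only [conjTranspose_mul, conjTranspose_conjTranspose]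
      rw [hA.eq]
      calc V * (Zᴴ * Uᴴ) * (U * diagonal (fun i => (a i : ℂ)) * Uᴴ) =
          V * (Zᴴ * ((Uᴴ * U) * (diagonal (fun i => (a i : ℂ)) * Uᴴ))) := by
            simp only [Matrix.mul_assoc]
        _ = _ := by rw [hA.star_mul, Matrix.one_mul]
    rw [e, Matrix.trace_mul_comm]
    simp only [Matrix.mul_assoc]
  have h2 : (A * ((U * Z * Vᴴ) * (U * Z * Vᴴ)ᴴ)).trace =
      (diagonal (fun i => (a i : ℂ)) * (Z * Zᴴ)).trace := by
    have e : A * ((U * Z * Vᴴ) * (U * Z * Vᴴ)ᴴ) =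
        U * (diagonal (fun i => (a i : ℂ)) * (Z * Zᴴ) * Uᴴ) := by
      simp only [conjTranspose_mul, conjTranspose_conjTranspose]
      rw [hA.eq]
      calc U * diagonal (fun i => (a i : ℂ)) * Uᴴ * (U * Z * Vᴴ * (V * (Zᴴ * Uᴴ))) =
          U * (diagonal (fun i => (a i : ℂ)) * (Uᴴ * U) * (Z * (Vᴴ * V) * Zᴴ) * Uᴴ) := by
            simp only [Matrix.mul_assoc]
        _ = _ := by rw [hA.star_mul, hB.star_mul, Matrix.mul_one, Matrix.mul_one]
    rw [e, Matrix.trace_mul_comm, Matrix.mul_assoc, hA.star_mul, Matrix.mul_one]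
  have h3 : (B * ((U * Z * Vᴴ)ᴴ * (U * Z * Vᴴ))).trace =
      (diagonal (fun j => (b j : ℂ)) * (Zᴴ * Zᴴᴴ)).trace := by
    have e : B * ((U * Z * Vᴴ)ᴴ * (U * Z * Vᴴ)) =
        V * (diagonal (fun j => (b j : ℂ)) * (Zᴴ * Zᴴᴴ) * Vᴴ) := by
      simp only [conjTranspose_mul, conjTranspose_conjTranspose]
      rw [hB.eq]
      calc V * diagonal (fun j => (b j : ℂ)) * Vᴴ * (V * (Zᴴ * Uᴴ) * (U * Z * Vᴴ)) =
          V * (diagonal (fun j => (b j : ℂ)) * (Vᴴ * V) * (Zᴴ * (Uᴴ * U) * Z) * Vᴴ) := by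
            simp only [Matrix.mul_assoc]
        _ = _ := by rw [hA.star_mul, hB.star_mul, Matrix.mul_one, Matrix.mul_one]
    rw [e, Matrix.trace_mul_comm, Matrix.mul_assoc, hB.star_mul, Matrix.mul_one]
  rw [resolventForm, h1, h2, h3, trace_diagonal_mul_self, trace_diagonal_mul_self]
  have h4 : (Zᴴ * (diagonal (fun i => (a i : ℂ)) * (Uᴴ * V))).trace.re =
      ∑ i, ∑ j, a i * (star (Z i j) * (Uᴴ * V) i j).re := by
    rw [Finset.sum_comm, Matrix.trace, Complex.re_sum]
    refine Finset.sum_congr rfl fun j _ => ?_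
    rw [diag_apply, Matrix.mul_apply, Complex.re_sum]
    refine Finset.sum_congr rfl fun i _ => ?_
    rw [diagonal_mul, conjTranspose_apply, mul_left_comm, Complex.re_ofReal_mul]
  have h5 : ∑ j, ∑ i, b j * Complex.normSq (Zᴴ j i) = ∑ i, ∑ j, b j * Complex.normSq (Z i j) := by
    rw [Finset.sum_comm]
    simp [conjTranspose_apply]
  rw [h4, h5, Finset.mul_sum, Finset.mul_sum, ← Finset.sum_sub_distrib, ← Finset.sum_sub_distrib]
  refine Finset.sum_congr rfl fun i _ => ?_
  rw [Finset.mul_sum, Finset.mul_sum, ← Finset.sum_sub_distrib, ← Finset.sum_sub_distrib]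
  refine Finset.sum_congr rfl fun j _ => ?_
  ring

theorem resolventForm_le {A B : Matrix n n ℂ} (hA0 : A.PosSemidef) (hB0 : B.PosSemidef)
    {U : Matrix n ι ℂ} {a : ι → ℝ}
    (hA : Diagonalizes A U a) {V : Matrix n κ ℂ} {b : κ → ℝ} (hB : Diagonalizes B V b)
    {s : ℝ} (hs : 0 < s) (Y : Matrix n n ℂ) :
    resolventForm s A B Y ≤
      ∑ i, ∑ j, overlap U V i j * a i * (a i / (s * a i + b j)) := by
  have hY : Y = U * (Uᴴ * Y * V) * Vᴴ := by
    calc Y = (U * Uᴴ) * Y * (V * Vᴴ) := by rw [hA.mul_star, hB.mul_star]; simp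
      _ = _ := by simp only [Matrix.mul_assoc]
  rw [hY, resolventForm_conj hA hB]
  refine Finset.sum_le_sum fun i _ => Finset.sum_le_sum fun j _ => ?_
  generalize (Uᴴ * Y * V) i j = z
  rw [overlap]
  generalize (Uᴴ * V) i j = w
  have ha := hA.nonneg hA0 i
  have hb := hB.nonneg hB0 j
  rcases ha.eq_or_lt with h0 | h0
  · rw [← h0]
    have := mul_nonneg hb (Complex.normSq_nonneg z)
    simpa using this
  · have hd : 0 < s * a i + b j := by positivity
    rw [mul_div_assoc', le_div_iff₀ hd]
    have hn := Complex.normSq_nonneg (a i * w - (s * a i + b j : ℝ) * z)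
    rw [Complex.normSq_apply] at hn
    simp only [Complex.normSq_apply]
    simp only [Complex.sub_re, Complex.sub_im, Complex.re_ofReal_mul, Complex.im_ofReal_mul] at hn
    simp only [Complex.star_def, Complex.mul_re, Complex.conj_re, Complex.conj_im]
    nlinarith

theorem exists_resolventForm_eq {A B : Matrix n n ℂ} (hA0 : A.PosSemidef) (hB0 : B.PosSemidef)
    {U : Matrix n ι ℂ} {a : ι → ℝ}
    (hA : Diagonalizes A U a) {V : Matrix n κ ℂ} {b : κ → ℝ} (hB : Diagonalizes B V b)
    {s : ℝ} (hs : 0 < s) :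
    ∃ Y, resolventForm s A B Y =
      ∑ i, ∑ j, overlap U V i j * a i * (a i / (s * a i + b j)) := by
  refine ⟨U * (of fun i j => ((a i / (s * a i + b j) : ℝ) : ℂ) * (Uᴴ * V) i j) * Vᴴ, ?_⟩
  rw [resolventForm_conj hA hB]
  refine Finset.sum_congr rfl fun i _ => Finset.sum_congr rfl fun j _ => ?_
  rw [overlap, of_apply]
  generalize (Uᴴ * V) i j = w
  have ha := hA.nonneg hA0 i
  have hb := hB.nonneg hB0 j
  rcases ha.eq_or_lt with h0 | h0
  · rw [← h0]
    simp
  · have hd : s * a i + b j ≠ 0 := by positivity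
    simp only [Complex.normSq_apply, Complex.star_def, Complex.mul_re, Complex.conj_re,
      Complex.conj_im, Complex.im_ofReal_mul, Complex.ofReal_re, Complex.ofReal_im]
    field_simp
    ring

end Variational

section Channels

variable {n m l κ : Type*} [Fintype n] [DecidableEq n] [Fintype m] [DecidableEq m]
  [Fintype l] [Fintype κ] [DecidableEq κ]

/-- The column of blocks `D p`. -/
def blockColumn (D : κ → Matrix n l ℂ) : Matrix (κ × n) l ℂ := of fun p j => D p.1 p.2 j

theorem block_blockColumn (D : κ → Matrix n l ℂ) (A : Matrix l l ℂ) (p q : κ) :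
    (of fun i j => (blockColumn D * A * (blockColumn D)ᴴ) (p, i) (q, j)) =
      D p * A * (D q)ᴴ := by
  ext i j
  simp [blockColumn, Matrix.mul_apply]

theorem trace_blockColumn (C : κ → Matrix m l ℂ) (P : Matrix (κ × m) (κ × m) ℂ) :
    ((blockColumn C)ᴴ * P * blockColumn C).trace =
      ∑ p, ∑ q, ((C p)ᴴ * (of fun i j => P (p, i) (q, j)) * C q).trace := by
  simp only [← trace_sum]
  congr 1
  ext i j
  simp only [Matrix.sum_apply, Matrix.mul_apply, blockColumn, conjTranspose_apply,
    of_apply, Fintype.sum_prod_type, Finset.sum_mul]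
  refine Eq.trans (Finset.sum_congr rfl fun q _ => ?_) Finset.sum_comm
  exact Finset.sum_comm

theorem ampliate_equiv {κ' : Type*} (e : κ ≃ κ') (Λ : Matrix n n ℂ →ₗ[ℂ] Matrix m m ℂ)
    (M : Matrix (κ × n) (κ × n) ℂ) :
    ampliate κ Λ M =
      (ampliate κ' Λ (M.submatrix (Prod.map e.symm id) (Prod.map e.symm id))).submatrix
        (Prod.map e id) (Prod.map e id) := by
  ext p q
  simp [ampliate]

/-- The adjoint of `Λ` with respect to the trace pairing. -/
def traceDual (Λ : Matrix n n ℂ →ₗ[ℂ] Matrix m m ℂ) (N : Matrix m m ℂ) : Matrix n n ℂ :=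
  of fun i j => (Λ (single j i 1) * N).trace

theorem trace_map_mul (Λ : Matrix n n ℂ →ₗ[ℂ] Matrix m m ℂ) (M : Matrix n n ℂ)
    (N : Matrix m m ℂ) : (Λ M * N).trace = (M * traceDual Λ N).trace := by
  have hM : M = ∑ i, ∑ j, M i j • single i j (1 : ℂ) := by
    conv_lhs => rw [matrix_eq_sum_single M]
    simp [smul_single]
  conv_lhs => rw [hM]
  simp only [map_sum, map_smul, Matrix.sum_mul, trace_sum, smul_mul, trace_smul]
  simp only [Matrix.trace, diag_apply, Matrix.mul_apply, traceDual, of_apply, smul_eq_mul]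

namespace IsChannel

variable {Λ : Matrix n n ℂ →ₗ[ℂ] Matrix m m ℂ}

theorem posSemidef_ampliate (hΛ : IsChannel Λ) {M : Matrix (κ × n) (κ × n) ℂ}
    (hM : M.PosSemidef) : (ampliate κ Λ M).PosSemidef := by
  rw [ampliate_equiv (Fintype.equivFin κ)]
  exact (hΛ.completelyPositive _ _ (hM.submatrix _)).submatrix _

theorem posSemidef_map (hΛ : IsChannel Λ) {M : Matrix n n ℂ} (hM : M.PosSemidef) :
    (Λ M).PosSemidef :=
  (hΛ.posSemidef_ampliate (κ := Unit) (hM.submatrix Prod.snd)).submatrix (fun i => ((), i))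

theorem isState_map (hΛ : IsChannel Λ) {M : Matrix n n ℂ} (hM : IsState M) : IsState (Λ M) :=
  ⟨hΛ.posSemidef_map hM.1, (hΛ.tracePreserving M).trans hM.2⟩

theorem posSemidef_ampliate_blockColumn (hΛ : IsChannel Λ) (D : κ → Matrix n l ℂ)
    {A : Matrix l l ℂ} (hA : A.PosSemidef) :
    (of fun p q : κ × m => Λ (D p.1 * A * (D q.1)ᴴ) p.2 q.2).PosSemidef := by
  have := hΛ.posSemidef_ampliate (hA.mul_mul_conjTranspose_same (blockColumn D))
  simpa only [ampliate, block_blockColumn] using this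

theorem map_conjTranspose (hΛ : IsChannel Λ) (X : Matrix n n ℂ) : Λ Xᴴ = (Λ X)ᴴ := by
  have h := (hΛ.posSemidef_ampliate_blockColumn (κ := Fin 2) ![1, X]
    (PosSemidef.one (n := n))).isHermitian
  ext i j
  have := h.apply (0, i) (1, j)
  simpa using this.symm

/-- The Schwarz inequality for the adjoint of a channel. -/
theorem trace_traceDual_le (hΛ : IsChannel Λ) {A : Matrix n n ℂ} (hA : A.PosSemidef)
    (Y : Matrix m m ℂ) :
    (A * (traceDual Λ Y * (traceDual Λ Y)ᴴ)).trace.re ≤ (Λ A * (Y * Yᴴ)).trace.re := by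
  set K := traceDual Λ Y with hK
  have h := ((hΛ.posSemidef_ampliate_blockColumn (κ := Fin 2) ![1, -Kᴴ] hA
    ).conjTranspose_mul_mul_same (blockColumn ![Y, 1])).trace_nonneg
  rw [trace_blockColumn] at h
  have e : ∀ p q : Fin 2, (of fun i j => (of fun p q : Fin 2 × m =>
      Λ ((![1, -Kᴴ] : Fin 2 → _) p.1 * A * ((![1, -Kᴴ] : Fin 2 → _) q.1)ᴴ) p.2 q.2)
        (p, i) (q, j)) =
      Λ ((![1, -Kᴴ] : Fin 2 → _) p * A * ((![1, -Kᴴ] : Fin 2 → _) q)ᴴ) := fun p q => rfl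
  simp only [e, Fin.sum_univ_two, cons_val_zero, cons_val_one, conjTranspose_one,
    conjTranspose_neg, conjTranspose_conjTranspose, Matrix.one_mul, Matrix.mul_one,
    Matrix.neg_mul, Matrix.mul_neg, map_neg, trace_neg, neg_neg] at h
  have h10 : (Λ (Kᴴ * A) * Y).trace = (Kᴴ * A * K).trace := trace_map_mul Λ _ Y
  have h01 : (Yᴴ * Λ (A * K)).trace.re = (Kᴴ * A * K).trace.re := by
    have : Yᴴ * Λ (A * K) = (Λ (Kᴴ * A) * Y)ᴴ := by
      rw [conjTranspose_mul, ← hΛ.map_conjTranspose, conjTranspose_mul,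
        conjTranspose_conjTranspose, hA.isHermitian.eq]
    rw [this, trace_conjTranspose, h10]
    simp
  have h11 : (Λ (Kᴴ * A * K)).trace = (Kᴴ * A * K).trace := hΛ.tracePreserving _
  have h00 : (Yᴴ * Λ A * Y).trace = (Λ A * (Y * Yᴴ)).trace := by
    rw [Matrix.mul_assoc, Matrix.trace_mul_comm, Matrix.mul_assoc]
  have hL : (A * (K * Kᴴ)).trace = (Kᴴ * A * K).trace := by
    rw [← Matrix.mul_assoc, Matrix.trace_mul_comm, Matrix.mul_assoc]
  have hre := (Complex.le_def.1 h).1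
  simp only [Complex.add_re, Complex.neg_re, Complex.zero_re, h10, h01, h11, h00] at hre
  rw [hL]
  linarith

theorem traceDual_conjTranspose (hΛ : IsChannel Λ) (Y : Matrix m m ℂ) :
    traceDual Λ Yᴴ = (traceDual Λ Y)ᴴ := by
  ext i j
  rw [conjTranspose_apply, traceDual, traceDual, of_apply, of_apply, ← trace_conjTranspose,
    conjTranspose_mul, ← hΛ.map_conjTranspose, conjTranspose_single, star_one,
    Matrix.trace_mul_comm]

theorem resolventForm_map_le (hΛ : IsChannel Λ) {A B : Matrix n n ℂ} (hA : A.PosSemidef)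
    (hB : B.PosSemidef) {s : ℝ} (hs : 0 ≤ s) (Y : Matrix m m ℂ) :
    resolventForm s (Λ A) (Λ B) Y ≤ resolventForm s A B (traceDual Λ Y) := by
  have h1 := mul_le_mul_of_nonneg_left (hΛ.trace_traceDual_le hA Y) hs
  have h2 := hΛ.trace_traceDual_le hB Yᴴ
  rw [hΛ.traceDual_conjTranspose, conjTranspose_conjTranspose, conjTranspose_conjTranspose] at h2
  have h3 : (Yᴴ * Λ A).trace = ((traceDual Λ Y)ᴴ * A).trace := by
    rw [Matrix.trace_mul_comm, trace_map_mul, hΛ.traceDual_conjTranspose, Matrix.trace_mul_comm]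
  rw [resolventForm, resolventForm, h3]
  linarith

/-- The data processing inequality. -/
theorem relEntropy_map_le (hΛ : IsChannel Λ) {A B : Matrix n n ℂ} (hA : A.PosSemidef)
    (hB : B.PosSemidef) : relEntropy (Λ A) (Λ B) ≤ relEntropy A B := by
  have hA' := hΛ.posSemidef_map hA
  have hB' := hΛ.posSemidef_map hB
  obtain ⟨U, a, ha⟩ := hA.isHermitian.exists_diagonalizes
  obtain ⟨V, b, hb⟩ := hB.isHermitian.exists_diagonalizes
  obtain ⟨U', a', ha'⟩ := hA'.isHermitian.exists_diagonalizes
  obtain ⟨V', b', hb'⟩ := hB'.isHermitian.exists_diagonalizes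
  rw [relEntropy_eq hA hb, relEntropy_eq hA' hb']
  by_cases hs : ∀ j, b j = 0 → population V A j = 0
  swap
  · rw [if_neg hs]; exact le_top
  have hres : ∀ s : ℝ, 0 < s →
      ∑ x : m × m, overlap U' V' x.1 x.2 * a' x.1 * (a' x.1 / (s * a' x.1 + b' x.2)) ≤
        ∑ x : n × n, overlap U V x.1 x.2 * a x.1 * (a x.1 / (s * a x.1 + b x.2)) := by
    intro s hs
    rw [Fintype.sum_prod_type, Fintype.sum_prod_type]
    obtain ⟨Y, hY⟩ := exists_resolventForm_eq hA' hB' ha' hb' hs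
    rw [← hY]
    exact (hΛ.resolventForm_map_le hA hB hs.le Y).trans (resolventForm_le hA hB ha hb hs _)
  have hb0 : ∀ x : n × n, b x.2 = 0 → overlap U V x.1 x.2 * a x.1 = 0 := fun x hx =>
    overlap_mul_eq_zero_of_population hA ha (hs _ hx) x.1
  have hb0' : ∀ x : m × m, b' x.2 = 0 → overlap U' V' x.1 x.2 * a' x.1 = 0 :=
    eq_zero_of_resolvent_le (c := fun x : n × n => overlap U V x.1 x.2 * a x.1)
      (a := fun x => a x.1) (b := fun x => b x.2)
      (c' := fun x : m × m => overlap U' V' x.1 x.2 * a' x.1)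
      (a' := fun x => a' x.1) (b' := fun x => b' x.2)
      (fun x => mul_nonneg (overlap_nonneg _ _ _ _) (ha.nonneg hA _)) (fun x => ha.nonneg hA _)
      (fun x => hb.nonneg hB _) hb0
      (fun x => mul_nonneg (overlap_nonneg _ _ _ _) (ha'.nonneg hA' _))
      (fun x => ha'.nonneg hA' _) (fun x => hb'.nonneg hB' _)
      (fun x hx => by simp [hx]) hres
  have hs' : ∀ j, b' j = 0 → population V' (Λ A) j = 0 := by
    intro j hj
    rw [population_eq_sum_overlap ha']
    exact Finset.sum_eq_zero fun i _ => hb0' (i, j) hj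
  have hsum : ∑ x : n × n, overlap U V x.1 x.2 * a x.1 =
      ∑ x : m × m, overlap U' V' x.1 x.2 * a' x.1 := by
    have htr := hΛ.tracePreserving A
    rw [ha.trace_eq, ha'.trace_eq] at htr
    have htr : ∑ i, a' i = ∑ i, a i := by exact_mod_cast htr
    rw [Fintype.sum_prod_type, Fintype.sum_prod_type]
    simp only [← Finset.sum_mul, sum_overlap_right ha.star_mul hb.mul_star,
      sum_overlap_right ha'.star_mul hb'.mul_star, one_mul, htr]
  rw [if_pos hs, if_pos hs', EReal.coe_le_coe_iff, negEntropy_sub_eq_sum_overlap ha hb,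
    negEntropy_sub_eq_sum_overlap ha' hb', ← Fintype.sum_prod_type', ← Fintype.sum_prod_type']
  exact sum_mul_log_le_of_resolvent_le (c := fun x : n × n => overlap U V x.1 x.2 * a x.1)
      (a := fun x => a x.1) (b := fun x => b x.2)
      (c' := fun x : m × m => overlap U' V' x.1 x.2 * a' x.1)
      (a' := fun x => a' x.1) (b' := fun x => b' x.2)
      (fun x => ha.nonneg hA _) (fun x => hb.nonneg hB _) (fun x hx => by simp [hx]) hb0
      (fun x => ha'.nonneg hA' _) (fun x => hb'.nonneg hB' _) (fun x hx => by simp [hx]) hb0'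
      hsum hres

end IsChannel

end Channels

section MatrixFacts

variable {n m : Type*} [Fintype n] [DecidableEq n] [Fintype m] [DecidableEq m]

open scoped Matrix.Norms.L2Operator MatrixOrder in
theorem span_posSemidef : Submodule.span ℂ {A : Matrix n n ℂ | A.PosSemidef} = ⊤ := by
  have := CStarAlgebra.span_nonneg (A := Matrix n n ℂ)
  simpa only [Matrix.nonneg_iff_posSemidef] using this

theorem IsFullRank.eq_zero_of_mulVec {ρ : Matrix n n ℂ} (h : IsFullRank ρ) (v : n → ℂ)
    (hv : ρ *ᵥ v = 0) : v = 0 := by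
  have hsurj : Function.Surjective ρ.mulVecLin := by
    rw [← LinearMap.range_eq_top]
    apply Submodule.eq_top_of_finrank_eq
    rw [Module.finrank_fintype_fun_eq_card]
    exact h
  exact LinearMap.injective_iff_surjective.2 hsurj (by simpa using hv)

theorem relEntropy_lt_top_of_isFullRank {ρ : Matrix n n ℂ} (h : IsFullRank ρ)
    (γ : Matrix n n ℂ) : relEntropy γ ρ < ⊤ := by
  rw [relEntropy, if_pos fun v hv => by rw [h.eq_zero_of_mulVec v hv, mulVec_zero]]
  exact EReal.coe_lt_top _

theorem traceNorm_real_smul {c : ℝ} (hc : 0 ≤ c) (M : Matrix n n ℂ) :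
    traceNorm (c • M) = c * traceNorm M := by
  obtain ⟨U, a, ha⟩ := (posSemidef_conjTranspose_mul_self M).isHermitian.exists_diagonalizes
  have hc' : Diagonalizes ((c • M)ᴴ * (c • M)) U (fun i => c ^ 2 * a i) := by
    refine ⟨ha.star_mul, ha.mul_star, ?_⟩
    have e : (fun i => ((c ^ 2 * a i : ℝ) : ℂ)) = (c ^ 2) • fun i => (a i : ℂ) := by
      ext i; simp
    rw [e, diagonal_smul, Matrix.mul_smul U, Matrix.smul_mul _ (U * _), ← ha.eq, conjTranspose_smul,
      Matrix.mul_smul, Matrix.smul_mul, smul_smul, star_trivial, pow_two]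
  have htr : ∀ (b : n → ℝ), (U * diagonal (fun i => (b i : ℂ)) * Uᴴ).trace.re = ∑ i, b i := by
    intro b
    rw [Matrix.trace_mul_comm, ← Matrix.mul_assoc, ha.star_mul, Matrix.one_mul, trace_diagonal]
    simp
  rw [traceNorm, traceNorm, hc'.cfc_eq, ha.cfc_eq, htr, htr, Finset.mul_sum]
  refine Finset.sum_congr rfl fun i _ => ?_
  rw [Real.sqrt_mul (sq_nonneg c), Real.sqrt_sq hc]

theorem IsState.convexCombination {ρ σ : Matrix n n ℂ} (hρ : IsState ρ) (hσ : IsState σ) {δ : ℝ}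
    (h0 : 0 ≤ δ) (h1 : δ ≤ 1) : IsState (ρ + δ • (σ - ρ)) := by
  have e : ρ + δ • (σ - ρ) = (1 - δ) • ρ + δ • σ := by module
  rw [e]
  refine ⟨(hρ.1.smul (sub_nonneg.2 h1)).add (hσ.1.smul h0), ?_⟩
  rw [trace_add, trace_smul, trace_smul, hρ.2, hσ.2]
  simp

theorem isChannel_reindex (e : n ≃ m) :
    IsChannel (reindexLinearEquiv ℂ ℂ e e).toLinearMap where
  completelyPositive k M hM := hM.submatrix (Prod.map id e.symm)
  tracePreserving M := by
    simp only [Matrix.trace, LinearEquiv.coe_coe, coe_reindexLinearEquiv, diag_apply,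
      reindex_apply, submatrix_apply]
    exact Equiv.sum_comp e.symm (fun i => M i i)

end MatrixFacts

namespace Systems

variable {Sys : Type u} {Q : Systems.{u, v} Sys}

theorem posSemidef_tensor {A B : Sys} {ρ : Q.Mat A} {ω : Q.Mat B} (hρ : ρ.PosSemidef)
    (hω : ω.PosSemidef) : (tensor ρ ω).PosSemidef := (hρ.kronecker hω).submatrix _

theorem traceSnd_tensor {A B : Sys} (ρ : Q.Mat A) (ω : Q.Mat B) :
    traceSnd (tensor ρ ω) = ω.trace • ρ := by
  ext i j
  simp [traceSnd, tensor, Matrix.trace, ← Finset.mul_sum, mul_comm]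

theorem trace_traceSnd {A B : Sys} (M : Q.Mat (Q.comp A B)) : (traceSnd M).trace = M.trace := by
  simp only [Matrix.trace, diag_apply, traceSnd, of_apply]
  rw [← Fintype.sum_prod_type', ← Equiv.sum_comp (Q.pair A B).symm]

theorem trace_tensor {A B : Sys} (ρ : Q.Mat A) (ω : Q.Mat B) :
    (tensor ρ ω).trace = ρ.trace * ω.trace := by
  rw [← trace_traceSnd, traceSnd_tensor, trace_smul, smul_eq_mul, mul_comm]

theorem isState_tensor {A B : Sys} {ρ : Q.Mat A} {ω : Q.Mat B} (hρ : IsState ρ)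
    (hω : IsState ω) : IsState (tensor ρ ω) :=
  ⟨posSemidef_tensor hρ.1 hω.1, by rw [trace_tensor, hρ.2, hω.2, one_mul]⟩

/-- `id_R ⊗ Λ` as a linear map. -/
def idTensorLinear (R : Sys) {A B : Sys} (Λ : Q.Op A B) : Q.Op (Q.comp R A) (Q.comp R B) where
  toFun := idTensor R Λ
  map_add' M N := by
    ext p q
    simp only [idTensor, ampliate, submatrix_apply, of_apply, Matrix.add_apply]
    rw [← Matrix.add_apply, ← map_add]
    rfl
  map_smul' c M := by
    ext p q
    simp only [idTensor, ampliate, submatrix_apply, of_apply, Matrix.smul_apply, RingHom.id_apply]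
    rw [← Matrix.smul_apply, ← map_smul]
    rfl

theorem isChannel_idTensorLinear (R : Sys) {A B : Sys} {Λ : Q.Op A B} (hΛ : IsChannel Λ) :
    IsChannel (idTensorLinear R Λ) where
  completelyPositive k M hM :=
    (hΛ.posSemidef_ampliate (κ := Fin k × Q.Idx R) (hM.submatrix
      fun x => (x.1.1, (Q.pair R A).symm (x.1.2, x.2)))).submatrix
      fun p : Fin k × Q.Idx (Q.comp R B) => ((p.1, (Q.pair R B p.2).1), (Q.pair R B p.2).2)
  tracePreserving M := by
    have h : ∀ {C : Sys} (N : Q.Mat (Q.comp R C)), N.trace =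
        ∑ r, (of fun i j => N ((Q.pair R C).symm (r, i)) ((Q.pair R C).symm (r, j))).trace := by
      intro C N
      simp only [Matrix.trace, diag_apply, of_apply]
      rw [← Fintype.sum_prod_type', ← Equiv.sum_comp (Q.pair R C).symm]
    rw [h, h M]
    refine Finset.sum_congr rfl fun r _ => ?_
    rw [← hΛ.tracePreserving]
    congr 1
    ext i j
    simp [idTensorLinear, idTensor, ampliate]

theorem isChannel_induced {S S' C : Sys} {Λ : Q.Op (Q.comp S C) (Q.comp S' C)}
    (hΛ : IsChannel Λ) {τ : Q.Mat C} (hτ : IsState τ) : IsChannel (induced Λ τ) where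
  completelyPositive k M hM := by
    have h := hΛ.posSemidef_ampliate (κ := Fin k) ((hM.kronecker hτ.1).submatrix
      fun x : Fin k × Q.Idx (Q.comp S C) => ((x.1, (Q.pair S C x.2).1), (Q.pair S C x.2).2))
    have e : ampliate (Fin k) (induced Λ τ) M = ∑ c, (ampliate (Fin k) Λ
        ((M ⊗ₖ τ).submatrix
          (fun x : Fin k × Q.Idx (Q.comp S C) => ((x.1, (Q.pair S C x.2).1), (Q.pair S C x.2).2))
          fun x : Fin k × Q.Idx (Q.comp S C) =>
            ((x.1, (Q.pair S C x.2).1), (Q.pair S C x.2).2))).submatrix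
        (fun p : Fin k × Q.Idx S' => (p.1, (Q.pair S' C).symm (p.2, c)))
        (fun p : Fin k × Q.Idx S' => (p.1, (Q.pair S' C).symm (p.2, c))) := by
      ext p q
      rw [Matrix.sum_apply]
      rfl
    rw [e]
    exact posSemidef_sum _ fun c _ => h.submatrix _
  tracePreserving M := by
    change (traceSnd (Λ (tensor M τ))).trace = _
    rw [trace_traceSnd, hΛ.tracePreserving, trace_tensor, hτ.2, mul_one]

theorem idTensor_regroup_tensor (R : Sys) {S S' C : Sys} {Λ : Q.Op (Q.comp S C) (Q.comp S' C)}
    {τ : Q.Mat C} {Φ : Q.Op S S'} (h : ∀ X, Λ (tensor X τ) = tensor (Φ X) τ)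
    (γ : Q.Mat (Q.comp R S)) :
    idTensor R Λ (reindex (Q.regroup R S C) (Q.regroup R S C) (tensor γ τ)) =
      reindex (Q.regroup R S' C) (Q.regroup R S' C) (tensor (idTensor R Φ γ) τ) := by
  ext p q
  have e : ∀ r r' : Q.Idx R, (of fun i j => tensor γ τ
      ((Q.regroup R S C).symm ((Q.pair R (Q.comp S C)).symm (r, i)))
      ((Q.regroup R S C).symm ((Q.pair R (Q.comp S C)).symm (r', j)))) =
      tensor (of fun i j => γ ((Q.pair R S).symm (r, i)) ((Q.pair R S).symm (r', j))) τ := by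
    intro r r'
    ext i j
    simp [regroup, tensor]
  simp only [idTensor, ampliate, reindex_apply, submatrix_apply, of_apply, e, h]
  simp [regroup, tensor]

theorem traceFst_idTensor_tensor {R A B : Sys} (Λ : Q.Op A B) (ω : Q.Mat R) (γ : Q.Mat A) :
    traceFst (idTensor R Λ (tensor ω γ)) = ω.trace • Λ γ := by
  ext i j
  have e : ∀ r r' : Q.Idx R, (of fun i j => tensor ω γ ((Q.pair R A).symm (r, i))
      ((Q.pair R A).symm (r', j))) = ω r r' • γ := by
    intro r r'
    ext i j
    simp [tensor]
  simp only [traceFst, idTensor, ampliate, submatrix_apply, of_apply, e, map_smul,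
    Equiv.apply_symm_apply, Matrix.smul_apply, Matrix.trace, diag_apply, smul_eq_mul,
    Finset.sum_mul]

/-- The product basis of two bases. -/
def productBasis {A B : Sys} (U : Q.Mat A) (V : Q.Mat B) :
    Matrix (Q.Idx (Q.comp A B)) (Q.Idx A × Q.Idx B) ℂ :=
  (U ⊗ₖ V).submatrix (Q.pair A B) id

theorem diagonalizes_tensor {A B : Sys} {ρ U : Q.Mat A} {ω V : Q.Mat B} {a : Q.Idx A → ℝ}
    {b : Q.Idx B → ℝ} (hρ : Diagonalizes ρ U a) (hω : Diagonalizes ω V b) :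
    Diagonalizes (tensor ρ ω) (productBasis U V) (fun p => a p.1 * b p.2) := by
  have hstar : (productBasis U V)ᴴ = (Uᴴ ⊗ₖ Vᴴ).submatrix id (Q.pair A B) := by
    rw [productBasis, conjTranspose_submatrix, conjTranspose_kronecker]
  refine ⟨?_, ?_, ?_⟩
  · rw [hstar, productBasis, submatrix_mul_equiv, ← mul_kronecker_mul, hρ.star_mul, hω.star_mul,
      one_kronecker_one, submatrix_id_id]
  · rw [hstar, productBasis, ← submatrix_mul _ _ _ id _ Function.bijective_id,
      ← mul_kronecker_mul, hρ.mul_star, hω.mul_star,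
      one_kronecker_one, submatrix_one_equiv]
  · have hd : diagonal (fun p : Q.Idx A × Q.Idx B => ((a p.1 * b p.2 : ℝ) : ℂ)) =
        diagonal (fun i => (a i : ℂ)) ⊗ₖ diagonal (fun i => (b i : ℂ)) := by
      rw [diagonal_kronecker_diagonal]; simp
    have : productBasis U V * diagonal (fun p : Q.Idx A × Q.Idx B => ((a p.1 * b p.2 : ℝ) : ℂ)) =
        ((U * diagonal (fun i => (a i : ℂ))) ⊗ₖ (V * diagonal (fun i => (b i : ℂ)))).submatrix
          (Q.pair A B) id := by
      rw [hd, mul_kronecker_mul, productBasis, submatrix_mul _ _ _ id _ Function.bijective_id,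
        submatrix_id_id]
    rw [this, hstar, ← submatrix_mul _ _ _ id _ Function.bijective_id, ← mul_kronecker_mul,
      ← hρ.eq, ← hω.eq, tensor]

theorem trace_mul_tensor_one {A B : Sys} (M : Q.Mat (Q.comp A B)) (X : Q.Mat A) :
    (M * tensor X 1).trace = (traceSnd M * X).trace := by
  simp only [Matrix.trace, diag_apply, Matrix.mul_apply, traceSnd, of_apply, Finset.sum_mul]
  rw [← Equiv.sum_comp (Q.pair A B).symm, Fintype.sum_prod_type]
  refine Finset.sum_congr rfl fun i _ => ?_
  refine Eq.trans (Finset.sum_congr rfl fun k _ => ?_) Finset.sum_comm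
  rw [← Equiv.sum_comp (Q.pair A B).symm, Fintype.sum_prod_type]
  refine Finset.sum_congr rfl fun j _ => ?_
  simp [tensor, Matrix.one_apply]

theorem trace_mul_one_tensor {A B : Sys} (M : Q.Mat (Q.comp A B)) (X : Q.Mat B) :
    (M * tensor 1 X).trace = (traceFst M * X).trace := by
  simp only [Matrix.trace, diag_apply, Matrix.mul_apply, traceFst, of_apply, Finset.sum_mul]
  rw [← Equiv.sum_comp (Q.pair A B).symm, Fintype.sum_prod_type_right]
  refine Finset.sum_congr rfl fun i _ => ?_
  refine Eq.trans (Finset.sum_congr rfl fun k _ => ?_) Finset.sum_comm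
  rw [← Equiv.sum_comp (Q.pair A B).symm, Fintype.sum_prod_type_right]
  refine Finset.sum_congr rfl fun j _ => ?_
  simp [tensor, Matrix.one_apply]

theorem traceFst_tensor {A B : Sys} (ρ : Q.Mat A) (ω : Q.Mat B) :
    traceFst (tensor ρ ω) = ρ.trace • ω := by
  ext i j
  simp [traceFst, tensor, Matrix.trace, ← Finset.sum_mul]

theorem trace_traceFst {A B : Sys} (M : Q.Mat (Q.comp A B)) : (traceFst M).trace = M.trace := by
  simp only [Matrix.trace, diag_apply, traceFst, of_apply]
  rw [← Fintype.sum_prod_type_right', ← Equiv.sum_comp (Q.pair A B).symm]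

theorem isState_traceSnd {A B : Sys} {M : Q.Mat (Q.comp A B)} (hM : IsState M) :
    IsState (traceSnd M) := by
  refine ⟨?_, (trace_traceSnd M).trans hM.2⟩
  have : traceSnd M = ∑ k, M.submatrix (fun i => (Q.pair A B).symm (i, k))
      (fun i => (Q.pair A B).symm (i, k)) := by
    ext i j; simp [traceSnd, Matrix.sum_apply]
  rw [this]
  exact posSemidef_sum _ fun k _ => hM.1.submatrix _

theorem isState_traceFst {A B : Sys} {M : Q.Mat (Q.comp A B)} (hM : IsState M) :
    IsState (traceFst M) := by
  refine ⟨?_, (trace_traceFst M).trans hM.2⟩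
  have : traceFst M = ∑ k, M.submatrix (fun i => (Q.pair A B).symm (k, i))
      (fun i => (Q.pair A B).symm (k, i)) := by
    ext i j; simp [traceFst, Matrix.sum_apply]
  rw [this]
  exact posSemidef_sum _ fun k _ => hM.1.submatrix _

section Populations

variable {A B : Sys} {U : Q.Mat A} {V : Q.Mat B}

theorem sum_population_productBasis_fst (hU : Uᴴ * U = 1) (hU' : U * Uᴴ = 1) (hV : Vᴴ * V = 1)
    (hV' : V * Vᴴ = 1) (M : Q.Mat (Q.comp A B)) (x : Q.Idx A → ℝ) :
    ∑ p, population (productBasis U V) M p * x p.1 =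
      ∑ i, population U (traceSnd M) i * x i := by
  have h1 : Diagonalizes (U * diagonal (fun i => (x i : ℂ)) * Uᴴ) U x := ⟨hU, hU', rfl⟩
  have h2 : Diagonalizes (1 : Q.Mat B) V 1 := ⟨hV, hV', by simp [hV']⟩
  have h3 := (diagonalizes_tensor h1 h2).eq
  simp only [Pi.one_apply, mul_one] at h3
  rw [← re_trace_mul_conj_diagonal, ← re_trace_mul_conj_diagonal, ← h3, trace_mul_tensor_one]

theorem sum_population_productBasis_snd (hU : Uᴴ * U = 1) (hU' : U * Uᴴ = 1) (hV : Vᴴ * V = 1)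
    (hV' : V * Vᴴ = 1) (M : Q.Mat (Q.comp A B)) (x : Q.Idx B → ℝ) :
    ∑ p, population (productBasis U V) M p * x p.2 =
      ∑ j, population V (traceFst M) j * x j := by
  have h1 : Diagonalizes (V * diagonal (fun i => (x i : ℂ)) * Vᴴ) V x := ⟨hV, hV', rfl⟩
  have h2 : Diagonalizes (1 : Q.Mat A) U 1 := ⟨hU, hU', by simp [hU']⟩
  have h3 := (diagonalizes_tensor h2 h1).eq
  simp only [Pi.one_apply, one_mul] at h3
  rw [← re_trace_mul_conj_diagonal, ← re_trace_mul_conj_diagonal, ← h3, trace_mul_one_tensor]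

theorem population_traceSnd (hU : Uᴴ * U = 1) (hU' : U * Uᴴ = 1) (hV : Vᴴ * V = 1)
    (hV' : V * Vᴴ = 1) (M : Q.Mat (Q.comp A B)) (i : Q.Idx A) :
    population U (traceSnd M) i = ∑ j, population (productBasis U V) M (i, j) := by
  have := sum_population_productBasis_fst hU hU' hV hV' M (Pi.single i 1)
  simpa [Fintype.sum_prod_type_right, Pi.single_apply] using this.symm

theorem population_traceFst (hU : Uᴴ * U = 1) (hU' : U * Uᴴ = 1) (hV : Vᴴ * V = 1)
    (hV' : V * Vᴴ = 1) (M : Q.Mat (Q.comp A B)) (j : Q.Idx B) :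
    population V (traceFst M) j = ∑ i, population (productBasis U V) M (i, j) := by
  have := sum_population_productBasis_snd hU hU' hV hV' M (Pi.single j 1)
  simpa [Fintype.sum_prod_type, Pi.single_apply] using this.symm

end Populations

/-- The relative entropy to a product state is the sum of the relative entropies of the marginals
and the mutual information. -/
theorem relEntropy_tensor {A B : Sys} {M : Q.Mat (Q.comp A B)} (hM : IsState M) {ρ : Q.Mat A}
    {ω : Q.Mat B} (hρ : IsState ρ) (hω : IsState ω) :
    relEntropy M (tensor ρ ω) = relEntropy (traceSnd M) ρ + relEntropy (traceFst M) ω +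
      ((negEntropy M - negEntropy (traceSnd M) - negEntropy (traceFst M) : ℝ) : EReal) := by
  obtain ⟨U, a, ha⟩ := hρ.1.isHermitian.exists_diagonalizes
  obtain ⟨V, b, hb⟩ := hω.1.isHermitian.exists_diagonalizes
  have hpos := population_nonneg (productBasis U V) hM.1
  have hsupp : (∀ p : Q.Idx A × Q.Idx B, a p.1 * b p.2 = 0 →
      population (productBasis U V) M p = 0) ↔
      (∀ i, a i = 0 → population U (traceSnd M) i = 0) ∧
        ∀ j, b j = 0 → population V (traceFst M) j = 0 := by
    simp only [population_traceSnd ha.star_mul ha.mul_star hb.star_mul hb.mul_star,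
      population_traceFst ha.star_mul ha.mul_star hb.star_mul hb.mul_star,
      Finset.sum_eq_zero_iff_of_nonneg fun _ _ => hpos _, Finset.mem_univ, true_imp_iff,
      mul_eq_zero, Prod.forall]
    grind
  rw [relEntropy_eq hM.1 (diagonalizes_tensor ha hb), relEntropy_eq (isState_traceSnd hM).1 ha,
    relEntropy_eq (isState_traceFst hM).1 hb]
  by_cases h : ∀ p : Q.Idx A × Q.Idx B, a p.1 * b p.2 = 0 →
      population (productBasis U V) M p = 0
  · rw [if_pos h, if_pos (hsupp.1 h).1, if_pos (hsupp.1 h).2, ← EReal.coe_add, ← EReal.coe_add,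
      EReal.coe_eq_coe_iff,
      ← sum_population_productBasis_fst ha.star_mul ha.mul_star hb.star_mul hb.mul_star,
      ← sum_population_productBasis_snd ha.star_mul ha.mul_star hb.star_mul hb.mul_star]
    have : ∑ p, population (productBasis U V) M p * Real.log (a p.1 * b p.2) =
        ∑ p, population (productBasis U V) M p * Real.log (a p.1) +
          ∑ p, population (productBasis U V) M p * Real.log (b p.2) := by
      rw [← Finset.sum_add_distrib]
      refine Finset.sum_congr rfl fun p _ => ?_
      by_cases hp : a p.1 * b p.2 = 0
      · simp [h p hp]
      · rw [Real.log_mul (left_ne_zero_of_mul hp) (right_ne_zero_of_mul hp), mul_add]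
    rw [this]
    ring
  · rw [if_neg h]
    rw [hsupp, not_and_or] at h
    rcases h with h | h <;> rw [if_neg h] <;> split_ifs <;>
      simp only [EReal.top_add_coe, EReal.coe_add_top, EReal.top_add_top]

end Systems

namespace Systems

variable {Sys : Type u} {Q : Systems.{u, v} Sys}

theorem mutualInformation_nonneg {A B : Sys} {M : Q.Mat (Q.comp A B)} (hM : IsState M) :
    0 ≤ negEntropy M - negEntropy (traceSnd M) - negEntropy (traceFst M) := by
  have h := relEntropy_tensor hM (isState_traceSnd hM) (isState_traceFst hM)
  rw [relEntropy_self, relEntropy_self, zero_add, zero_add] at h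
  have h0 := relEntropy_nonneg hM (isState_tensor (isState_traceSnd hM) (isState_traceFst hM))
  rw [h] at h0
  exact_mod_cast h0

theorem relEntropy_marginals_le {A B : Sys} {M : Q.Mat (Q.comp A B)} (hM : IsState M)
    {ρ : Q.Mat A} {ω : Q.Mat B} (hρ : IsState ρ) (hω : IsState ω) :
    relEntropy (traceSnd M) ρ + relEntropy (traceFst M) ω ≤ relEntropy M (tensor ρ ω) := by
  rw [relEntropy_tensor hM hρ hω]
  exact le_add_of_nonneg_right (by exact_mod_cast mutualInformation_nonneg hM)

theorem relEntropy_tensor_tensor {A B : Sys} {ρ γ : Q.Mat A} {ω γ' : Q.Mat B} (hγ : IsState γ)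
    (hγ' : IsState γ') (hρ : IsState ρ) (hω : IsState ω) :
    relEntropy (tensor γ γ') (tensor ρ ω) = relEntropy γ ρ + relEntropy γ' ω := by
  have hM := isState_tensor hγ hγ'
  have e1 : traceSnd (tensor γ γ') = γ := by rw [traceSnd_tensor, hγ'.2, one_smul]
  have e2 : traceFst (tensor γ γ') = γ' := by rw [traceFst_tensor, hγ.2, one_smul]
  have h := relEntropy_tensor hM hγ hγ'
  rw [e1, e2, relEntropy_self, relEntropy_self, relEntropy_self, zero_add, zero_add] at h
  rw [relEntropy_tensor hM hρ hω, e1, e2, ← h, add_zero]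

/-- `X ↦ X ⊗ ω` as a linear map. -/
def tensorRight {A B : Sys} (ω : Q.Mat B) : Q.Op A (Q.comp A B) where
  toFun X := tensor X ω
  map_add' X Y := by
    ext i j; simp [tensor, Matrix.kroneckerMap_apply, add_mul]
  map_smul' c X := by
    ext i j; simp [tensor, Matrix.kroneckerMap_apply, mul_assoc]

end Systems

theorem linearMap_ext_of_isState {n : Type*} [Fintype n] [DecidableEq n] {E : Type*}
    [AddCommGroup E] [Module ℂ E] {f g : Matrix n n ℂ →ₗ[ℂ] E}
    (h : ∀ ρ, IsState ρ → f ρ = g ρ) : f = g := by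
  refine LinearMap.ext_on (s := {A : Matrix n n ℂ | A.PosSemidef}) span_posSemidef ?_
  intro A (hA : A.PosSemidef)
  obtain ⟨U, a, ha⟩ := hA.isHermitian.exists_diagonalizes
  have htr := ha.trace_eq
  have hnn : 0 ≤ ∑ i, a i := Finset.sum_nonneg fun i _ => ha.nonneg hA i
  set t := ∑ i, a i
  rcases hnn.eq_or_lt with h0 | h0
  · rw [← h0, Complex.ofReal_zero, hA.trace_eq_zero_iff] at htr
    rw [htr, map_zero, map_zero]
  · have ht : (t : ℂ) ≠ 0 := by exact_mod_cast h0.ne'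
    have hs : IsState ((t : ℂ)⁻¹ • A) := by
      refine ⟨?_, by rw [trace_smul, htr, smul_eq_mul, inv_mul_cancel₀ ht]⟩
      have : (t : ℂ)⁻¹ • A = t⁻¹ • A := by
        ext i j; simp
      rw [this]
      exact hA.smul (inv_nonneg.2 hnn)
    have := h _ hs
    rw [map_smul, map_smul] at this
    exact smul_right_injective E (inv_ne_zero ht) this

namespace ResourceTheory

open Systems

variable {Sys : Type u} {Q : Systems.{u, v} Sys} (T : ResourceTheory Q)

theorem revRelEntropy_nonneg {X : Sys} {ρ : Q.Mat X} (hρ : IsState ρ) :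
    0 ≤ T.revRelEntropy ρ :=
  le_iInf₂ fun γ hγ => relEntropy_nonneg (T.free_isState X γ hγ) hρ

theorem mem_free_of_revRelEntropy_le_zero {X : Sys} {ρ : Q.Mat X} (hρ : IsState ρ)
    (h : T.revRelEntropy ρ ≤ 0) : ρ ∈ T.free X := by
  have hex : ∀ k : ℕ, ∃ γ ∈ T.free X, relEntropy γ ρ < ((1 / ((k : ℝ) + 1) : ℝ) : EReal) := by
    intro k
    have hk : (0 : EReal) < ((1 / ((k : ℝ) + 1) : ℝ) : EReal) := by
      rw [EReal.coe_pos]; positivity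
    have := h.trans_lt hk
    rw [revRelEntropy] at this
    simpa only [iInf_lt_iff, exists_prop] using this
  choose γ hγ hlt using hex
  refine (T.free_closed X).mem_of_tendsto (f := γ) (b := Filter.atTop) ?_
    (Filter.Eventually.of_forall hγ)
  refine tendsto_pi_nhds.2 fun i => tendsto_pi_nhds.2 fun j => ?_
  rw [tendsto_iff_norm_sub_tendsto_zero]
  have hsq : Filter.Tendsto (fun k => ‖γ k i j - ρ i j‖ ^ 2) Filter.atTop (nhds 0) := by
    refine squeeze_zero (fun k => by positivity) (fun k => ?_)
      (by simpa using (tendsto_one_div_add_atTop_nhds_zero_nat (𝕜 := ℝ)).const_mul 4)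
    have h1 := (trace_sq_sub_le_relEntropy (T.free_isState X _ (hγ k)) hρ).trans (hlt k).le
    rw [EReal.coe_le_coe_iff, one_div] at h1
    have h2 := norm_sq_le_trace_re (γ k - ρ) i j
    rw [Matrix.sub_apply] at h2
    linarith
  have := (Real.continuous_sqrt.tendsto 0).comp hsq
  simpa [Function.comp_def, Real.sqrt_sq (norm_nonneg _)] using this

theorem revRelEntropy_eq_zero_iff {X : Sys} {ρ : Q.Mat X} (hρ : IsState ρ) :
    T.revRelEntropy ρ = 0 ↔ ρ ∈ T.free X := by
  refine ⟨fun h => T.mem_free_of_revRelEntropy_le_zero hρ h.le, fun h => ?_⟩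
  refine le_antisymm ?_ (T.revRelEntropy_nonneg hρ)
  exact (iInf₂_le ρ h).trans relEntropy_self.le

theorem revRelEntropy_lt_top {X : Sys} {ρ : Q.Mat X} (hρ : IsFullRank ρ) :
    T.revRelEntropy ρ < ⊤ := by
  obtain ⟨γ, hγ, -⟩ := T.exists_fullRank X
  exact (iInf₂_le γ hγ).trans_lt (relEntropy_lt_top_of_isFullRank hρ γ)

/-- Channels that map free states to free states do not increase the reversed relative entropy
of resource. -/
theorem revRelEntropy_map_le {A B : Sys} {Λ : Q.Op A B} (hΛ : IsChannel Λ)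
    (hfree : ∀ γ ∈ T.free A, Λ γ ∈ T.free B) {ρ : Q.Mat A} (hρ : IsState ρ) :
    T.revRelEntropy (Λ ρ) ≤ T.revRelEntropy ρ :=
  le_iInf₂ fun γ hγ => (iInf₂_le (Λ γ) (hfree γ hγ)).trans
    (hΛ.relEntropy_map_le (T.free_isState A γ hγ).1 hρ.1)

variable {T} in
theorem IsFreeOp.map_mem_free {A B : Sys} {Λ : Q.Op A B} (hΛ : T.IsFreeOp Λ) {γ : Q.Mat A}
    (hγ : γ ∈ T.free A) : Λ γ ∈ T.free B := by
  have h := T.traceFst_mem _ _ _ (hΛ.crng A _ (T.tensor_mem A A γ hγ γ hγ))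
  rwa [traceFst_idTensor_tensor, (T.free_isState A γ hγ).2, one_smul] at h

theorem revRelEntropy_tensor {A B : Sys} {ρ : Q.Mat A} {ω : Q.Mat B} (hρ : IsState ρ)
    (hω : IsState ω) :
    T.revRelEntropy (tensor ρ ω) = T.revRelEntropy ρ + T.revRelEntropy ω := by
  have hρ0 := T.revRelEntropy_nonneg hρ
  have hω0 := T.revRelEntropy_nonneg hω
  apply le_antisymm
  · refine EReal.le_add_of_forall_gt (Or.inl ?_) (Or.inr ?_) ?_
    · exact (EReal.bot_lt_zero.trans_le hρ0).ne'
    · exact (EReal.bot_lt_zero.trans_le hω0).ne'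
    · intro x hx y hy
      rw [revRelEntropy] at hx hy
      simp only [iInf_lt_iff, exists_prop, gt_iff_lt] at hx hy
      obtain ⟨γ, hγ, hγx⟩ := hx
      obtain ⟨γ', hγ', hγy⟩ := hy
      refine (iInf₂_le _ (T.tensor_mem A B γ hγ γ' hγ')).trans ?_
      rw [relEntropy_tensor_tensor (T.free_isState _ _ hγ) (T.free_isState _ _ hγ') hρ hω]
      exact add_le_add hγx.le hγy.le
  · refine le_iInf₂ fun γ hγ => ?_
    refine le_trans ?_ (relEntropy_marginals_le (T.free_isState _ _ hγ) hρ hω)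
    exact add_le_add (iInf₂_le _ (T.traceSnd_mem A B γ hγ)) (iInf₂_le _ (T.traceFst_mem A B γ hγ))

theorem revRelEntropy_regroup_le {A B C : Sys} {ρ : Q.Mat (Q.comp (Q.comp A B) C)}
    (hρ : IsState ρ) :
    T.revRelEntropy (reindex (Q.regroup A B C) (Q.regroup A B C) ρ) ≤ T.revRelEntropy ρ :=
  T.revRelEntropy_map_le (isChannel_reindex (Q.regroup A B C))
    (fun γ hγ => (T.free_regroup A B C γ).1 hγ) hρ

theorem revRelEntropy_le_regroup {A B C : Sys} {ρ : Q.Mat (Q.comp (Q.comp A B) C)}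
    (hρ : IsState ρ) :
    T.revRelEntropy ρ ≤ T.revRelEntropy (reindex (Q.regroup A B C) (Q.regroup A B C) ρ) := by
  have h := T.revRelEntropy_map_le (isChannel_reindex (Q.regroup A B C).symm)
    (fun γ hγ => (T.free_regroup A B C _).2 (by simpa using hγ))
    ((isChannel_reindex (Q.regroup A B C)).isState_map hρ)
  simpa using h

variable {T} in
theorem IsStrictRobustCatalysis.map_tensor {S S' C : Sys}
    {Λ : Q.Op (Q.comp S C) (Q.comp S' C)} {ρ : Q.Mat S} {ε : ℝ} {τ : Q.Mat C}
    (h : T.IsStrictRobustCatalysis Λ ρ ε τ) (X : Q.Mat S) :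
    Λ (tensor X τ) = tensor (induced Λ τ X) τ := by
  have hτ := h.catalyst_isState
  have hnear : ∀ σ : Q.Mat S, IsState σ → traceNorm (σ - ρ) ≤ ε →
      Λ (tensor σ τ) = tensor (induced Λ τ σ) τ := by
    intro σ hσ hd
    obtain ⟨σ', -, hσ'⟩ := h.uncorrelated σ hσ hd
    have : induced Λ τ σ = σ' := by
      change traceSnd (Λ (tensor σ τ)) = σ'
      rw [hσ', traceSnd_tensor, hτ.2, one_smul]
    rw [this, hσ']
  have hrad : ∀ σ : Q.Mat S, ∃ δ : ℝ, 0 < δ ∧ δ ≤ 1 ∧ traceNorm (δ • (σ - ρ)) ≤ ε := by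
    intro σ
    have hN : 0 < |traceNorm (σ - ρ)| + 1 := by positivity
    refine ⟨min 1 (ε / (|traceNorm (σ - ρ)| + 1)), lt_min one_pos (div_pos h.pos hN),
      min_le_left _ _, ?_⟩
    set δ := min 1 (ε / (|traceNorm (σ - ρ)| + 1)) with hδ
    have hδ0 : 0 ≤ δ := (lt_min one_pos (div_pos h.pos hN)).le
    rw [traceNorm_real_smul hδ0]
    calc δ * traceNorm (σ - ρ) ≤ δ * (|traceNorm (σ - ρ)| + 1) :=
          mul_le_mul_of_nonneg_left (by linarith [le_abs_self (traceNorm (σ - ρ))]) hδ0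
      _ ≤ ε / (|traceNorm (σ - ρ)| + 1) * (|traceNorm (σ - ρ)| + 1) :=
          mul_le_mul_of_nonneg_right (min_le_right _ _) hN.le
      _ = ε := div_mul_cancel₀ _ hN.ne'
  let f : Q.Op S (Q.comp S' C) := Λ ∘ₗ tensorRight τ
  let g : Q.Op S (Q.comp S' C) := tensorRight τ ∘ₗ induced Λ τ
  have hρ : f ρ = g ρ := by
    obtain ⟨δ, hδ, -, hle⟩ := hrad ρ
    refine hnear ρ h.state_isState ?_
    rwa [sub_self, smul_zero, ← sub_self ρ] at hle
  have hfg : f = g := by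
    refine linearMap_ext_of_isState fun σ hσ => ?_
    obtain ⟨δ, hδ, hδ1, hle⟩ := hrad σ
    have h1 : f (ρ + δ • (σ - ρ)) = g (ρ + δ • (σ - ρ)) :=
      hnear _ (h.state_isState.convexCombination hσ hδ.le hδ1) (by rwa [add_sub_cancel_left])
    have h2 : δ • (σ - ρ) = (δ : ℂ) • (σ - ρ) := by ext i j; simp
    rw [h2, map_add, map_add, hρ, map_smul, map_smul, map_sub, map_sub, hρ] at h1
    have h3 := smul_right_injective _ (by exact_mod_cast hδ.ne' : (δ : ℂ) ≠ 0)
      (add_left_cancel h1)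
    exact sub_left_injective h3
  exact congrArg (fun F : Q.Op S (Q.comp S' C) => F X) hfg

variable {T} in
theorem IsStrictRobustCatalysis.isFreeOp_induced {S S' C : Sys}
    {Λ : Q.Op (Q.comp S C) (Q.comp S' C)} {ρ : Q.Mat S} {ε : ℝ} {τ : Q.Mat C}
    (h : T.IsStrictRobustCatalysis Λ ρ ε τ) (hτ : IsFullRank τ) :
    T.IsFreeOp (induced Λ τ) := by
  have hch := isChannel_induced h.isFreeOp.isChannel h.catalyst_isState
  refine ⟨hch, fun R γ hγ => ?_⟩
  have hγs := T.free_isState _ _ hγ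
  have hγτ := isState_tensor hγs h.catalyst_isState
  have hout : IsState (idTensor R (induced Λ τ) γ) :=
    (isChannel_idTensorLinear R hch).isState_map hγs
  have hle : T.revRelEntropy (tensor (idTensor R (induced Λ τ) γ) τ) ≤
      T.revRelEntropy (tensor γ τ) := calc
    _ ≤ T.revRelEntropy (reindex (Q.regroup R S' C) (Q.regroup R S' C)
          (tensor (idTensor R (induced Λ τ) γ) τ)) :=
        T.revRelEntropy_le_regroup (isState_tensor hout h.catalyst_isState)
    _ = T.revRelEntropy (idTensorLinear R Λ
          (reindex (Q.regroup R S C) (Q.regroup R S C) (tensor γ τ))) := by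
        rw [← idTensor_regroup_tensor R h.map_tensor]; rfl
    _ ≤ T.revRelEntropy (reindex (Q.regroup R S C) (Q.regroup R S C) (tensor γ τ)) :=
        T.revRelEntropy_map_le (isChannel_idTensorLinear R h.isFreeOp.isChannel)
          (h.isFreeOp.crng R) ((isChannel_reindex (Q.regroup R S C)).isState_map hγτ)
    _ ≤ _ := T.revRelEntropy_regroup_le hγτ
  rw [T.revRelEntropy_tensor hout h.catalyst_isState,
    T.revRelEntropy_tensor hγs h.catalyst_isState, (T.revRelEntropy_eq_zero_iff hγs).2 hγ] at hle
  refine T.mem_free_of_revRelEntropy_le_zero hout ?_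
  have hτ0 := T.revRelEntropy_nonneg h.catalyst_isState
  have hτ1 := T.revRelEntropy_lt_top hτ
  lift T.revRelEntropy τ to ℝ using ⟨hτ1.ne, (EReal.bot_lt_zero.trans_le hτ0).ne'⟩ with t
  exact (EReal.addLECancellable_coe t).add_le_add_iff_right.1 hle

end ResourceTheory

end QRes

end

theorem mainTheorem5 {Sys : Type u} (Q : Systems.{u, v} Sys) (T : ResourceTheory Q) :
    -- the reversed relative entropy of resource is faithful
    (∀ (X : Sys) (ρ : Q.Mat X), IsState ρ →
      0 ≤ T.revRelEntropy ρ ∧ (T.revRelEntropy ρ = 0 ↔ ρ ∈ T.free X)) ∧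
    -- it is finite on full-rank states
    (∀ (X : Sys) (ρ : Q.Mat X), IsState ρ → IsFullRank ρ → T.revRelEntropy ρ < ⊤) ∧
    -- it is monotone under free operations
    (∀ (A B : Sys) (Λ : Q.Op A B) (ρ : Q.Mat A), T.IsFreeOp Λ → IsState ρ →
      T.revRelEntropy (Λ ρ) ≤ T.revRelEntropy ρ) ∧
    -- it is additive
    (∀ (A B : Sys) (ρ : Q.Mat A) (ω : Q.Mat B), IsState ρ → IsState ω →
      T.revRelEntropy (tensor ρ ω) = T.revRelEntropy ρ + T.revRelEntropy ω) ∧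
    -- strict robust catalysis with a full-rank catalyst maps free states to free states, and the
    -- operation that it induces on the system is free
    (∀ (S S' C : Sys) (Λ : Q.Op (Q.comp S C) (Q.comp S' C)) (ρ : Q.Mat S) (ε : ℝ) (τ : Q.Mat C),
      T.IsStrictRobustCatalysis Λ ρ ε τ → IsFullRank τ →
        (∀ γ ∈ T.free S, ∃ σ ∈ T.free S', Λ (tensor γ τ) = tensor σ τ) ∧
        T.IsFreeOp (induced Λ τ)) := by
  refine ⟨fun X ρ hρ => ⟨T.revRelEntropy_nonneg hρ, T.revRelEntropy_eq_zero_iff hρ⟩,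
    fun X ρ _ hfull => T.revRelEntropy_lt_top hfull,
    fun A B Λ ρ hΛ hρ => T.revRelEntropy_map_le hΛ.isChannel (fun γ hγ => hΛ.map_mem_free hγ) hρ,
    fun A B ρ ω hρ hω => T.revRelEntropy_tensor hρ hω, fun S S' C Λ ρ ε τ h hτ => ?_⟩
  have hfree := h.isFreeOp_induced hτ
  exact ⟨fun γ hγ => ⟨induced Λ τ γ, hfree.map_mem_free hγ, h.map_tensor γ⟩, hfree⟩
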